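/- Let $M$ be a smooth three-dimensional manifold with a co-oriented contact sub-Riemannian structure $(\mathcal D,g)$: $\mathcal D=\ker\omega$ is a plane field with $d\omega|_{\mathcal D}$ non-degenerate, $g$ is a smooth metric on $\mathcal D$, and the contact form $\omega$ is normalized so that $d\omega|_{\mathcal D}$ is the area form of $g$. Let $f_0$ be the Reeb field ($\omega(f_0)=1$, $d\omega(f_0,\cdot)=0$) and $g^1$ the Riemannian metric on $M$ with $g^1|_{\mathcal D}=g$, $g^1(\mathcal D,f_0)=0$, $g^1(f_0,f_0)=1$. Let $S\subset M$ be a smoothly embedded oriented surface, $\sigma^1$ the area form of $(S,g^1|_S)$, and $X$ the characteristic vector field of $S$, i.e. the smooth vector field on $S$ with $\iota_X\sigma^1=\omega|_S$. Write $|X|=\sqrt{g(X,X)}$ and define $\mathrm{div}(X)$ by $\mathrm{div}(X)\,\sigma^1=d(\iota_X\sigma^1)$. A point $q\in S$ is characteristic if $T_qS=\mathcal D_q$; then $X_q=0$, and $D_qX:T_qS\to T_qS$, $D_qX(Y)=[Y,X]_q$, is well defined. A characteristic point $q$ is degenerate if $\det(D_qX)=0$. A horizontal kernel extension at a degenerate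 characteristic point $q$ is a smooth arc-length parametrized curve $\gamma:(-\varepsilon,\varepsilon)\to S$ tangent to $\mathcal D$ with $\gamma(0)=q$ and $\dot\gamma(0)\in\ker D_qX$; put $\lambda_\gamma(t)=g(X,\dot\gamma(t))$. The order of degeneracy of $q$ is $1$ if $q$ is non-degenerate; if $q$ is degenerate, it is $k$ if for some horizontal kernel extension $\gamma$ at $q$ the order of vanishing of $\lambda_\gamma$ at $t=0$ (the least $j\ge 0$ with $\lambda_\gamma^{(j)}(0)\neq 0$) is $k$. Let $q\in S$ be a characteristic point of finite order of degeneracy $k\ge 2$. Then: (i) $q$ is an isolated characteristic point: some neighbourhood of $q$ in $S$ contains no other characteristic point. (ii) There are smooth local coordinates $(x,y)$ on a neighbourhood of $q$ in $S$ with $q=(0,0)$, and a constant $C>0$, such that on this neighbourhood $$C^{-1}\sqrt{x^2+y^{2k}}\le |X|\le C\sqrt{x^2+y^{2k}} .$$ (iii) The index $\mathrm{ind}(q)$ of $X$ at $q$ (the degree of $X/|X|$, read in local coordinates, on small circles around $q$) satisfies: if $k$ is odd, then for every horizontal kernel extension $\gamma$ at $q$ $$\mathrm{ind}(q)=\mathrm{sign}\left(\mathrm{div}_q(X)\,\Lambda^{(k)}(q)\right),\qquad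 \Lambda^{(k)}(q)=\left.\frac{d^k}{dt^k}\lambda_\gamma(t)\right|_{t=0};$$ if $k$ is even, then $\mathrm{ind}(q)=0$. -/

import Mathlib

open Set Filter Topology Manifold
open scoped ContDiff

noncomputable section

namespace ContactSR

/-! ### Calculus on manifolds: one-forms, two-forms, vector fields in coordinates -/

section Calculus

variable {n : ℕ} {N : Type*} [TopologicalSpace N] [ChartedSpace (EuclideanSpace ℝ (Fin n)) N]

/-- A one-form `α` written in the coordinates of the preferred chart `φ` at `p`, that is, the
pull-back `(φ⁻¹)^* α`, a function on `ℝⁿ` with values in the dual of `ℝⁿ`. -/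
def oneFormInChart (α : ∀ p : N, TangentSpace (𝓡 n) p →L[ℝ] ℝ) (p : N)
    (y : EuclideanSpace ℝ (Fin n)) : EuclideanSpace ℝ (Fin n) →L[ℝ] ℝ :=
  (α ((extChartAt (𝓡 n) p).symm y)).comp
    (mfderivWithin 𝓘(ℝ, EuclideanSpace ℝ (Fin n)) (𝓡 n) (extChartAt (𝓡 n) p).symm
      (range (𝓡 n)) y)

/-- The derivatives `∂_u (α(v))` at `p` of the components of a one-form in the preferred chart at `p`.
In Mathlib the tangent space at `p` is `ℝⁿ`, the components of a tangent vector being those in the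
preferred chart at `p`. -/
def derivOneForm (α : ∀ p : N, TangentSpace (𝓡 n) p →L[ℝ] ℝ) (p : N) :
    TangentSpace (𝓡 n) p →L[ℝ] TangentSpace (𝓡 n) p →L[ℝ] ℝ :=
  fderiv ℝ (oneFormInChart α p) (extChartAt (𝓡 n) p p)

/-- The exterior derivative `dα_p (u, v) = ∂_u (α(v)) - ∂_v (α(u))`, computed in the preferred chart
at `p`. -/
def dOneForm (α : ∀ p : N, TangentSpace (𝓡 n) p →L[ℝ] ℝ) (p : N)
    (u v : TangentSpace (𝓡 n) p) : ℝ :=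
  derivOneForm α p u v - derivOneForm α p v u

theorem dOneForm_self (α : ∀ p : N, TangentSpace (𝓡 n) p →L[ℝ] ℝ) (p : N)
    (u : TangentSpace (𝓡 n) p) : dOneForm α p u u = 0 := sub_self _

theorem dOneForm_swap (α : ∀ p : N, TangentSpace (𝓡 n) p →L[ℝ] ℝ) (p : N)
    (u v : TangentSpace (𝓡 n) p) : dOneForm α p u v = -dOneForm α p v u :=
  (neg_sub _ _).symm

theorem dOneForm_add_left (α : ∀ p : N, TangentSpace (𝓡 n) p →L[ℝ] ℝ) (p : N)
    (u u' v : TangentSpace (𝓡 n) p) :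
    dOneForm α p (u + u') v = dOneForm α p u v + dOneForm α p u' v := by
  simp only [dOneForm, map_add, add_apply]
  ring

theorem dOneForm_smul_left (α : ∀ p : N, TangentSpace (𝓡 n) p →L[ℝ] ℝ) (p : N)
    (c : ℝ) (u v : TangentSpace (𝓡 n) p) :
    dOneForm α p (c • u) v = c * dOneForm α p u v := by
  simp only [dOneForm, map_smul, smul_apply, smul_eq_mul]
  ring

theorem dOneForm_add_right (α : ∀ p : N, TangentSpace (𝓡 n) p →L[ℝ] ℝ) (p : N)
    (u v v' : TangentSpace (𝓡 n) p) :
    dOneForm α p u (v + v') = dOneForm α p u v + dOneForm α p u v' := by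
  rw [dOneForm_swap, dOneForm_add_left, dOneForm_swap α p u v, dOneForm_swap α p u v']
  ring

theorem dOneForm_smul_right (α : ∀ p : N, TangentSpace (𝓡 n) p →L[ℝ] ℝ) (p : N)
    (c : ℝ) (u v : TangentSpace (𝓡 n) p) :
    dOneForm α p u (c • v) = c * dOneForm α p u v := by
  rw [dOneForm_swap, dOneForm_smul_left, dOneForm_swap α p u v]
  ring

/-- A vector field `X` written in the coordinates of the preferred chart `φ` at `q`. -/
def fieldInChart (X : ∀ p : N, TangentSpace (𝓡 n) p) (q : N)
    (y : EuclideanSpace ℝ (Fin n)) : EuclideanSpace ℝ (Fin n) :=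
  VectorField.mpullbackWithin 𝓘(ℝ, EuclideanSpace ℝ (Fin n)) (𝓡 n) (extChartAt (𝓡 n) q).symm X
    (range (𝓡 n)) y

/-- The differential `D_q X : T_q N → T_q N` of a vector field `X` at a zero `q` of `X`. In
coordinates it is the Jacobian matrix of the components of `X`; see
`differentialAt_apply_eq_mlieBracket` for `D_q X (Y) = [Y, X]_q`. -/
def differentialAt (X : ∀ p : N, TangentSpace (𝓡 n) p) (q : N) :
    TangentSpace (𝓡 n) q →L[ℝ] TangentSpace (𝓡 n) q :=
  fderiv ℝ (fieldInChart X q) (extChartAt (𝓡 n) q q)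

/-- `D_q X (Y_q) = [Y, X]_q` for every vector field `Y`. -/
theorem differentialAt_apply_eq_mlieBracket [IsManifold (𝓡 n) ∞ N]
    (X Y : ∀ p : N, TangentSpace (𝓡 n) p) (q : N) (hq : X q = 0) :
    differentialAt X q (Y q) = VectorField.mlieBracket (𝓡 n) Y X q := by
  have hM : IsManifold (𝓡 n) 1 N := IsManifold.of_le (n := ∞) (by simp)
  have h1 (Z : ∀ p : N, TangentSpace (𝓡 n) p) :
      fieldInChart Z q (extChartAt (𝓡 n) q q) = Z q := by
    have h2 : (extChartAt (𝓡 n) q).symm (extChartAt (𝓡 n) q q) = q := extChartAt_to_inv q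
    have h3 := mfderivWithin_extChartAt_symm_inverse_apply (I := 𝓡 n) (x := q)
    unfold fieldInChart
    rw [VectorField.mpullbackWithin_apply]
    have h4 : ∀ q' (hq' : q' = q) , (Z q' : EuclideanSpace ℝ (Fin n)) = Z q := by
      rintro _ rfl; rfl
    erw [h4 _ h2]
    exact h3 (Z q)
  have h5 : VectorField.mlieBracket (𝓡 n) Y X q =
      ((ContinuousLinearMap.id ℝ (EuclideanSpace ℝ (Fin n))).inverse
        (VectorField.lieBracketWithin ℝ (fieldInChart Y q) (fieldInChart X q) univ
          (extChartAt (𝓡 n) q q)) : EuclideanSpace ℝ (Fin n)) := by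
    rw [VectorField.mlieBracket, VectorField.mlieBracketWithin_apply, mfderiv_extChartAt_self]
    simp only [preimage_univ, univ_inter]
    rw [ModelWithCorners.range_eq_univ]
    unfold fieldInChart
    rw [ModelWithCorners.range_eq_univ]
    rfl
  rw [h5, VectorField.lieBracketWithin_univ, VectorField.lieBracket, h1 X, h1 Y, hq]
  rw [ContinuousLinearMap.inverse_id]
  erw [map_zero, sub_zero]
  rfl

/-- `σ` is a smooth two-form. -/
structure IsTwoForm (σ : ∀ p : N, TangentSpace (𝓡 n) p →L[ℝ] TangentSpace (𝓡 n) p →L[ℝ] ℝ)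
    [IsManifold (𝓡 n) ∞ N] : Prop where
  smooth : ContMDiff (𝓡 n) ((𝓡 n).prod 𝓘(ℝ, EuclideanSpace ℝ (Fin n) →L[ℝ]
      EuclideanSpace ℝ (Fin n) →L[ℝ] ℝ)) ∞
    (fun p ↦ Bundle.TotalSpace.mk' (EuclideanSpace ℝ (Fin n) →L[ℝ]
      EuclideanSpace ℝ (Fin n) →L[ℝ] ℝ) p (σ p))
  alternating : ∀ p u, σ p u u = 0

end Calculus

/-! ### Contact sub-Riemannian manifolds -/

/-- A (co-oriented) contact sub-Riemannian structure `(𝓓, g)` on a three-dimensional manifold `M`: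
`𝓓 = ker ω` for the one-form `ω`, which is normalized with respect to `g`. -/
structure ContactSubRiemannian (M : Type*) [TopologicalSpace M] [ChartedSpace (EuclideanSpace ℝ (Fin 3)) M]
    [IsManifold (𝓡 3) ∞ M] where
  /-- The normalized contact form `ω`. -/
  form : ∀ p : M, TangentSpace (𝓡 3) p →L[ℝ] ℝ
  /-- The sub-Riemannian metric: a smooth metric on `𝓓` is the restriction to `𝓓` of a smooth field
  `g` of bilinear forms on `TM`. Only the restriction of `g p` to `𝓓_p` carries information; nothing
  is required of the other values, and nothing below depends on them. -/
  g : ∀ p : M, TangentSpace (𝓡 3) p →L[ℝ] TangentSpace (𝓡 3) p →L[ℝ] ℝ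
  smooth_form : ContMDiff (𝓡 3) ((𝓡 3).prod 𝓘(ℝ, EuclideanSpace ℝ (Fin 3) →L[ℝ] ℝ)) ∞
    (fun p ↦ Bundle.TotalSpace.mk' (EuclideanSpace ℝ (Fin 3) →L[ℝ] ℝ) p (form p))
  smooth_g : ContMDiff (𝓡 3) ((𝓡 3).prod 𝓘(ℝ, EuclideanSpace ℝ (Fin 3) →L[ℝ]
      EuclideanSpace ℝ (Fin 3) →L[ℝ] ℝ)) ∞
    (fun p ↦ Bundle.TotalSpace.mk' (EuclideanSpace ℝ (Fin 3) →L[ℝ]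
      EuclideanSpace ℝ (Fin 3) →L[ℝ] ℝ) p (g p))
  /-- `𝓓 = ker ω` is a plane field. -/
  form_ne_zero : ∀ p, form p ≠ 0
  /-- `𝓓` is a contact distribution: `dω` is non-degenerate on `𝓓`. -/
  contact : ∀ p u, form p u = 0 → u ≠ 0 → ∃ v, form p v = 0 ∧ dOneForm form p u v ≠ 0
  g_symm : ∀ p u v, form p u = 0 → form p v = 0 → g p u v = g p v u
  g_pos : ∀ p u, form p u = 0 → u ≠ 0 → 0 < g p u u
  /-- `ω` is normalized: `dω` takes the value one on the positively oriented orthonormal frames of `𝓓`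
  (and hence the value minus one on the negatively oriented ones), where `𝓓` is oriented by
  `dω|_𝓓`. -/
  normalized : ∀ p f₁ f₂, form p f₁ = 0 → form p f₂ = 0 → g p f₁ f₁ = 1 → g p f₂ f₂ = 1 →
    g p f₁ f₂ = 0 → |dOneForm form p f₁ f₂| = 1

section SubRiemannian

variable {M : Type*} [TopologicalSpace M] [ChartedSpace (EuclideanSpace ℝ (Fin 3)) M]
  [IsManifold (𝓡 3) ∞ M]

/-- `f` is the value at `p` of the Reeb vector field: `ω(f) = 1` and `dω(f, ·) = 0`. -/
def ContactSubRiemannian.IsReebAt (C : ContactSubRiemannian M) (p : M) (f : TangentSpace (𝓡 3) p) : Prop :=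
  C.form p f = 1 ∧ ∀ v, dOneForm C.form p f v = 0

theorem ContactSubRiemannian.existsUnique_isReebAt (C : ContactSubRiemannian M) (p : M) :
    ∃! f, C.IsReebAt p f := by
  have hfr : Module.finrank ℝ (TangentSpace (𝓡 3) p) = 3 := finrank_euclideanSpace_fin
  have hfin : Module.Finite ℝ (TangentSpace (𝓡 3) p) := Module.finite_of_finrank_pos (by omega)
  obtain ⟨w, hw⟩ : ∃ w, C.form p w = 1 := by
    obtain ⟨z, hz⟩ : ∃ z, C.form p z ≠ 0 := by
      by_contra! h
      exact C.form_ne_zero p (ContinuousLinearMap.ext h)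
    exact ⟨(C.form p z)⁻¹ • z, by simp [hz]⟩
  have hker : ∃ u, C.form p u = 0 ∧ u ≠ 0 := by
    by_contra! h
    have hinj : Function.Injective (C.form p).toLinearMap :=
      (injective_iff_map_eq_zero _).2 fun u hu ↦ h u hu
    have := LinearMap.finrank_le_finrank_of_injective hinj
    rw [hfr, Module.finrank_self] at this
    omega
  obtain ⟨a, ha, ha0⟩ := hker
  obtain ⟨b, hb, hab⟩ := C.contact p a ha ha0
  have hba : dOneForm C.form p b a = -dOneForm C.form p a b := dOneForm_swap _ _ _ _
  have hli : LinearIndependent ℝ ![a, b, w] := by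
    rw [Fintype.linearIndependent_iff]
    intro c hc
    simp only [Fin.sum_univ_three, Matrix.cons_val] at hc
    have h2 : c 2 = 0 := by simpa [ha, hb, hw] using congrArg (C.form p) hc
    rw [h2, zero_smul, add_zero] at hc
    have hz (v : TangentSpace (𝓡 3) p) : dOneForm C.form p v 0 = 0 := by
      simpa using dOneForm_smul_right C.form p 0 v 0
    have h1 : c 1 = 0 := by
      have := congrArg (dOneForm C.form p a) hc
      simpa [dOneForm_add_right, dOneForm_smul_right, dOneForm_self, hab, hz] using this
    have h0 : c 0 = 0 := by
      have := congrArg (dOneForm C.form p b) hc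
      simpa [dOneForm_add_right, dOneForm_smul_right, dOneForm_self, hab, hz, hba] using this
    intro j
    fin_cases j <;> assumption
  have hspan := hli.span_eq_top_of_card_eq_finrank' (by simp [hfr])
  have hall (v : TangentSpace (𝓡 3) p) : ∃ x y z : ℝ, v = x • a + y • b + z • w := by
    have hv : v ∈ Submodule.span ℝ (range ![a, b, w]) := by rw [hspan]; trivial
    obtain ⟨c, hc⟩ := (Submodule.mem_span_range_iff_exists_fun ℝ).1 hv
    exact ⟨c 0, c 1, c 2, by rw [← hc]; simp [Fin.sum_univ_three]⟩
  have haw : dOneForm C.form p a w = -dOneForm C.form p w a := dOneForm_swap _ _ _ _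
  have hbw : dOneForm C.form p b w = -dOneForm C.form p w b := dOneForm_swap _ _ _ _
  refine ⟨w + (-(dOneForm C.form p w b / dOneForm C.form p a b)) • a +
    (dOneForm C.form p w a / dOneForm C.form p a b) • b, ⟨by simp [ha, hb, hw], ?_⟩, ?_⟩
  · intro v
    obtain ⟨x, y, z, rfl⟩ := hall v
    simp only [dOneForm_add_left, dOneForm_add_right, dOneForm_smul_left, dOneForm_smul_right,
      dOneForm_self, hba, haw, hbw]
    field_simp
    ring
  · rintro f ⟨hf1, hf2⟩
    rw [← sub_eq_zero]
    by_contra hne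
    obtain ⟨v, hv, hdv⟩ := C.contact p _ (by simp [hf1, ha, hb, hw]) hne
    apply hdv
    obtain ⟨x, y, z, rfl⟩ := hall v
    rw [sub_eq_add_neg, ← neg_one_smul ℝ, dOneForm_add_left, dOneForm_smul_left, hf2]
    simp only [dOneForm_add_left, dOneForm_add_right, dOneForm_smul_left, dOneForm_smul_right,
      dOneForm_self, hba, haw, hbw]
    field_simp
    ring

/-- The Reeb vector field. -/
def ContactSubRiemannian.reeb (C : ContactSubRiemannian M) (p : M) : TangentSpace (𝓡 3) p :=
  (C.existsUnique_isReebAt p).choose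

theorem ContactSubRiemannian.isReebAt_reeb (C : ContactSubRiemannian M) (p : M) : C.IsReebAt p (C.reeb p) :=
  (C.existsUnique_isReebAt p).choose_spec.1

/-- The Riemannian metric `g¹` on `M` which extends `g` and for which the Reeb field is a unit field
orthogonal to `𝓓`: the vector `u - ω(u) f₀` is the horizontal component of `u`. -/
def ContactSubRiemannian.g₁ (C : ContactSubRiemannian M) (p : M) (u v : TangentSpace (𝓡 3) p) : ℝ :=
  C.g p (u - C.form p u • C.reeb p) (v - C.form p v • C.reeb p) + C.form p u * C.form p v

/-! ### Surfaces -/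

variable {S : Type*} [TopologicalSpace S] [ChartedSpace (EuclideanSpace ℝ (Fin 2)) S]
  [IsManifold (𝓡 2) ∞ S]

variable (S) in
/-- An orientation of a surface, given by a nowhere vanishing two-form: a frame `(v₁, v₂)` is
positively oriented when `τ (v₁, v₂) > 0`. -/
structure SurfaceOrientation where
  /-- The two-form. -/
  τ : ∀ p : S, TangentSpace (𝓡 2) p →L[ℝ] TangentSpace (𝓡 2) p →L[ℝ] ℝ
  isTwoForm : IsTwoForm τ
  ne_zero : ∀ p, τ p ≠ 0

variable (C : ContactSubRiemannian M) (i : S → M)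

/-- `p` is a characteristic point of the surface `i : S → M`: `T_p S = 𝓓_p`. -/
def IsCharacteristic (p : S) : Prop :=
  range (mfderiv (𝓡 2) (𝓡 3) i p) = {v | C.form (i p) v = 0}

/-- `σ` is the area form `σ¹` of the oriented Riemannian surface `(S, g¹|_S)`. -/
structure IsAreaForm (o : SurfaceOrientation S)
    (σ : ∀ p : S, TangentSpace (𝓡 2) p →L[ℝ] TangentSpace (𝓡 2) p →L[ℝ] ℝ) : Prop where
  isTwoForm : IsTwoForm σ
  eq_one : ∀ p v₁ v₂, 0 < o.τ p v₁ v₂ →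
    C.g₁ (i p) (mfderiv (𝓡 2) (𝓡 3) i p v₁) (mfderiv (𝓡 2) (𝓡 3) i p v₁) = 1 →
    C.g₁ (i p) (mfderiv (𝓡 2) (𝓡 3) i p v₂) (mfderiv (𝓡 2) (𝓡 3) i p v₂) = 1 →
    C.g₁ (i p) (mfderiv (𝓡 2) (𝓡 3) i p v₁) (mfderiv (𝓡 2) (𝓡 3) i p v₂) = 0 →
    σ p v₁ v₂ = 1

/-- `X` is the sub-Riemannian characteristic vector field of `S`, where `σ` is the area form `σ¹`:
it is the vector field with `ι_X σ¹ = ω|_S`. -/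
structure IsCharacteristicField
    (σ : ∀ p : S, TangentSpace (𝓡 2) p →L[ℝ] TangentSpace (𝓡 2) p →L[ℝ] ℝ)
    (X : ∀ p : S, TangentSpace (𝓡 2) p) : Prop where
  smooth : ContMDiff (𝓡 2) (𝓡 2).tangent ∞
    (fun p ↦ (⟨p, X p⟩ : TangentBundle (𝓡 2) S))
  interior_eq : ∀ p v, σ p (X p) v = C.form (i p) (mfderiv (𝓡 2) (𝓡 3) i p v)

/-- The divergence of `X` with respect to the area form `σ`, defined by
`div(X) σ = L_X σ = d (ι_X σ)`: the two two-forms are compared on the coordinate frame of `T_p S`;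
see `divergence_mul`. -/
def divergence (σ : ∀ p : S, TangentSpace (𝓡 2) p →L[ℝ] TangentSpace (𝓡 2) p →L[ℝ] ℝ)
    (X : ∀ p : S, TangentSpace (𝓡 2) p) (p : S) : ℝ :=
  dOneForm (fun p' ↦ σ p' (X p')) p (EuclideanSpace.single (0 : Fin 2) (1 : ℝ))
      (EuclideanSpace.single (1 : Fin 2) (1 : ℝ)) /
    σ p (EuclideanSpace.single (0 : Fin 2) (1 : ℝ)) (EuclideanSpace.single (1 : Fin 2) (1 : ℝ))

/-- The defining property `div(X) σ = d (ι_X σ)` of the divergence. -/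
theorem divergence_mul {σ : ∀ p : S, TangentSpace (𝓡 2) p →L[ℝ] TangentSpace (𝓡 2) p →L[ℝ] ℝ}
    (hσ : IsTwoForm σ) (X : ∀ p : S, TangentSpace (𝓡 2) p) (p : S) (hp : σ p ≠ 0)
    (u v : TangentSpace (𝓡 2) p) :
    divergence σ X p * σ p u v = dOneForm (fun p' ↦ σ p' (X p')) p u v := by
  set e₀ : TangentSpace (𝓡 2) p := EuclideanSpace.single (0 : Fin 2) (1 : ℝ) with he₀
  set e₁ : TangentSpace (𝓡 2) p := EuclideanSpace.single (1 : Fin 2) (1 : ℝ) with he₁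
  have hall (v : TangentSpace (𝓡 2) p) : ∃ x y : ℝ, v = x • e₀ + y • e₁ := by
    have h (v : EuclideanSpace ℝ (Fin 2)) : v = v 0 • EuclideanSpace.single (0 : Fin 2) (1 : ℝ) +
        v 1 • EuclideanSpace.single (1 : Fin 2) (1 : ℝ) := by
      ext j; fin_cases j <;> simp
    exact ⟨_, _, h v⟩
  have hswap : σ p e₁ e₀ = -σ p e₀ e₁ := by
    have := hσ.alternating p (e₀ + e₁)
    simp only [map_add, add_apply, hσ.alternating] at this
    linarith
  have h0 : σ p e₀ e₁ ≠ 0 := by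
    intro h0
    apply hp
    ext u v
    obtain ⟨x, y, rfl⟩ := hall u
    obtain ⟨x', y', rfl⟩ := hall v
    simp [hσ.alternating, hswap, h0]
  have hd : divergence σ X p * σ p e₀ e₁ = dOneForm (fun p' ↦ σ p' (X p')) p e₀ e₁ :=
    div_mul_cancel₀ _ h0
  obtain ⟨x, y, rfl⟩ := hall u
  obtain ⟨x', y', rfl⟩ := hall v
  have hsw := dOneForm_swap (fun p' ↦ σ p' (X p')) p e₁ e₀
  simp only [dOneForm_add_left, dOneForm_add_right, dOneForm_smul_left, dOneForm_smul_right,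
      dOneForm_self, hsw, ← hd, map_add, map_smul, add_apply, smul_apply, smul_eq_mul,
      hσ.alternating, hswap]
  ring

/-- The sub-Riemannian norm `|X|` at `p` of the (horizontal) vector field `X` on `S`. -/
def srNorm (X : ∀ p : S, TangentSpace (𝓡 2) p) (p : S) : ℝ :=
  √(C.g (i p) (mfderiv (𝓡 2) (𝓡 3) i p (X p)) (mfderiv (𝓡 2) (𝓡 3) i p (X p)))

/-! ### Order of degeneracy -/

/-- The velocity `γ'(t)` of a curve in `S`. -/
def velocity (γ : ℝ → S) (t : ℝ) : TangentSpace (𝓡 2) (γ t) :=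
  mfderiv 𝓘(ℝ, ℝ) (𝓡 2) γ t (1 : ℝ)

/-- The restriction of `γ` to some interval `(-ε, ε)` is a horizontal kernel extension at `q`: a
smooth horizontal curve in `S`, parametrized by arc length, with `γ(0) = q` and
`γ'(0) ∈ ker D_q X`. -/
def IsHorizontalKernelExtension (X : ∀ p : S, TangentSpace (𝓡 2) p) (q : S) (γ : ℝ → S) : Prop :=
  ∃ ε : ℝ, 0 < ε ∧ ContMDiffOn 𝓘(ℝ, ℝ) (𝓡 2) ∞ γ (Ioo (-ε) ε) ∧
    (∀ t ∈ Ioo (-ε) ε,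
      C.form (i (γ t)) (mfderiv (𝓡 2) (𝓡 3) i (γ t) (velocity γ t)) = 0 ∧
      C.g (i (γ t)) (mfderiv (𝓡 2) (𝓡 3) i (γ t) (velocity γ t))
        (mfderiv (𝓡 2) (𝓡 3) i (γ t) (velocity γ t)) = 1) ∧
    γ 0 = q ∧ differentialAt X (γ 0) (velocity γ 0) = 0

/-- The function `λ_γ(t) = g(X, γ'(t))`. -/
def lam (X : ∀ p : S, TangentSpace (𝓡 2) p) (γ : ℝ → S) (t : ℝ) : ℝ :=
  C.g (i (γ t)) (mfderiv (𝓡 2) (𝓡 3) i (γ t) (X (γ t)))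
    (mfderiv (𝓡 2) (𝓡 3) i (γ t) (velocity γ t))

/-- The order of vanishing of `f` at `0` is the natural number `k`: it is the least `j` for which
the `j`-th derivative of `f` at `0` is non-zero. -/
def VanishesToOrder (f : ℝ → ℝ) (k : ℕ) : Prop :=
  IsLeast {j : ℕ | iteratedDeriv j f 0 ≠ 0} k

/-- The characteristic point `q` has (finite) order of degeneracy `k`: if `q` is non-degenerate this
means `k = 1`; if `q` is degenerate, `k` is the order of vanishing of `λ_γ` at `0` for some
horizontal kernel extension `γ` at `q`. -/
def HasOrderOfDegeneracy (X : ∀ p : S, TangentSpace (𝓡 2) p) (q : S) (k : ℕ) : Prop :=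
  IsCharacteristic C i q ∧
    (((differentialAt X q).det ≠ 0 ∧ k = 1) ∨
      ((differentialAt X q).det = 0 ∧
        ∃ γ : ℝ → S, IsHorizontalKernelExtension C i X q γ ∧ VanishesToOrder (lam C i X γ) k))

/-! ### Index of an isolated zero -/

/-- The vector field `X` on `S` has index `m` at `q`: in coordinates around `q`, on every small
circle around `q` the field has no zeros and the map `X / |X|` from the circle to the unit
circle has degree `m`. The degree is the increment of a continuous angle `θ` of `X` along the circle,
divided by `2π`. -/
def HasIndex (X : ∀ p : S, TangentSpace (𝓡 2) p) (q : S) (m : ℤ) : Prop :=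
  ∀ᶠ r in 𝓝[>] (0 : ℝ), ∃ θ : ℝ → ℝ, Continuous θ ∧
    (∀ t : ℝ, ∃ ρ : ℝ, 0 < ρ ∧
      fieldInChart X q (extChartAt (𝓡 2) q q + r • !₂[Real.cos t, Real.sin t]) =
        ρ • !₂[Real.cos (θ t), Real.sin (θ t)]) ∧
    θ (2 * Real.pi) - θ 0 = m * (2 * Real.pi)

end SubRiemannian

end ContactSR

end

noncomputable section

namespace ContactSR

/-! ### Planar vector fields with a degenerate zero -/

/-! The contact condition forces `D_q X` to have non-zero trace. Since `ι_X σ¹ = ω|_S`, the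
divergence at `q` is read off from `dω` on `T_q S = 𝓓_q`, where `dω` is non-degenerate; and since
`X_q = 0`, it equals the trace of `D_q X`. At a degenerate point `D_q X` therefore has a kernel
direction `e = γ'(0)` and a transverse eigenvector `f` with eigenvalue `τ = div_q X ≠ 0`
(`exists_transverse_eigenvector`).

In the preferred chart write `Y` for `X` and `c` for `γ`. Along a horizontal curve `X` is parallel
to the velocity, and unit speed makes the factor equal to `λ_γ`. Strict differentiability of `Y`
then yields, near the zero, `Y(c(s) + x f) = λ(s) c'(s) + x v` with `v` close to `τ f`
(`eventually_field_eq`). By Taylor, `λ(s) = s^k l(s)` with `l(0) = λ^(k)(0) / k! ≠ 0`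
(`exists_eq_pow_mul`). As `c'(s)` and `v` stay uniformly independent, `|Y|` is comparable to `√(x² +
s^(2k))` (`exists_norm_bounds`), and `|X|` to `|Y|`, because `g` is positive definite on `T_q S`
(`exists_srNorm_bounds`). This is (ii), and (i) follows since `X` vanishes at characteristic points.

For the index, two fields that are never opposite on a circle have the same degree there
(`IsAngle.exists_of_never_opposite`). With `Λ = λ^(k)(0)`, the field is compared for odd `k` with
the linear field having eigenvectors `e`, `f` and eigenvalues `Λ`, `τ`, whose degree is the sign of
`τ Λ`; for even `k` with the constant field `Λ e`, of degree zero. Finally, `|Y|` is at least a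
multiple of `|t|^k` along any curve transverse to `f`, so the order of vanishing is the same for all
kernel extensions (`vanishesToOrder`), and the odd case applies to each of them. -/

/-- The Euclidean plane. -/
abbrev Plane : Type := EuclideanSpace ℝ (Fin 2)

/-- The determinant of two vectors of the plane. -/
def cross (u v : Plane) : ℝ := u 0 * v 1 - u 1 * v 0

theorem cross_add_left (u u' v : Plane) : cross (u + u') v = cross u v + cross u' v := by
  simp [cross]; ring

theorem cross_add_right (u v v' : Plane) : cross u (v + v') = cross u v + cross u v' := by
  simp [cross]; ring

theorem cross_smul_left (a : ℝ) (u v : Plane) : cross (a • u) v = a * cross u v := by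
  simp [cross]; ring

theorem cross_smul_right (a : ℝ) (u v : Plane) : cross u (a • v) = a * cross u v := by
  simp [cross]; ring

theorem cross_self (u : Plane) : cross u u = 0 := by
  simp [cross]; ring

theorem cross_swap (u v : Plane) : cross u v = -cross v u := by
  simp [cross]; ring

theorem cross_zero_right (u : Plane) : cross u 0 = 0 := by simp [cross]

theorem cross_zero_left (u : Plane) : cross 0 u = 0 := by simp [cross]

theorem continuous_cross : Continuous fun p : Plane × Plane ↦ cross p.1 p.2 := by
  unfold cross; fun_prop

theorem abs_cross_le (u v : Plane) : |cross u v| ≤ 2 * (‖u‖ * ‖v‖) := by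
  have h (w : Plane) (i : Fin 2) : |w i| ≤ ‖w‖ := PiLp.norm_apply_le w i
  have h1 : |u 0 * v 1| ≤ ‖u‖ * ‖v‖ := by
    rw [abs_mul]; exact mul_le_mul (h u 0) (h v 1) (abs_nonneg _) (norm_nonneg _)
  have h2 : |u 1 * v 0| ≤ ‖u‖ * ‖v‖ := by
    rw [abs_mul]; exact mul_le_mul (h u 1) (h v 0) (abs_nonneg _) (norm_nonneg _)
  calc |cross u v| ≤ |u 0 * v 1| + |u 1 * v 0| := abs_sub _ _
    _ ≤ _ := by linarith

/-- In the plane, every vector is a combination of two independent ones. -/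
theorem cross_smul_eq (u v w : Plane) : cross u v • w = cross w v • u + cross u w • v := by
  ext j; fin_cases j <;> simp [cross] <;> ring

/-- The identity `htr` says that `A` has trace `τ`. As `A` kills `e`, Cayley–Hamilton gives `A² = τ
A`, so `A v` is an eigenvector; the same identity shows that it is independent of `e`. -/
theorem exists_eigenvector {A : Plane →L[ℝ] Plane} {e : Plane} (hAe : A e = 0) {τ : ℝ}
    (hτ : τ ≠ 0) {v : Plane} (hev : cross e v ≠ 0)
    (htr : cross (A e) v + cross e (A v) = τ * cross e v) :
    ∃ f : Plane, A f = τ • f ∧ cross e f ≠ 0 := by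
  rw [hAe, cross_zero_left, zero_add] at htr
  refine ⟨A v, ?_, by rw [htr]; exact mul_ne_zero hτ hev⟩
  have h := congrArg A (cross_smul_eq e v (A v))
  rw [map_add, map_smul, map_smul, map_smul, hAe, smul_zero, zero_add, htr] at h
  have h' : cross e v • (A (A v) - τ • A v) = 0 := by
    rw [smul_sub, h, smul_smul, mul_comm, sub_self]
  simpa [hev, sub_eq_zero] using h'

/-- A planar vector field `Y` with a zero at `z₀`, a curve `c` through `z₀` along which `Y` is
the multiple `lam` of the velocity, and an eigenvector `f` of the differential of `Y` transverse to
the curve. -/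
structure AdaptedCurve (Y : Plane → Plane) (A : Plane →L[ℝ] Plane) (z₀ f : Plane) (τ : ℝ)
    (c : ℝ → Plane) (lam : ℝ → ℝ) : Prop where
  field : HasStrictFDerivAt Y A z₀
  start : c 0 = z₀
  smooth : ContDiffAt ℝ ∞ c 0
  eigen : A f = τ • f
  eigenvalue : τ ≠ 0
  independent : cross (deriv c 0) f ≠ 0
  tangent : ∀ᶠ s in 𝓝 0, Y (c s) = lam s • deriv c s

/-- The map `(x, s) ↦ c(s) + x f`. -/
def adaptedMap (c : ℝ → Plane) (f : Plane) (w : Plane) : Plane := c (w 1) + w 0 • f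

theorem tendsto_coord_one : Tendsto (fun w : Plane ↦ w 1) (𝓝 0) (𝓝 0) := by
  have : Continuous fun w : Plane ↦ w 1 := by fun_prop
  simpa using this.tendsto 0

theorem tendsto_coord_zero : Tendsto (fun w : Plane ↦ w 0) (𝓝 0) (𝓝 0) := by
  have : Continuous fun w : Plane ↦ w 0 := by fun_prop
  simpa using this.tendsto 0

/-! ### Local form of the field near the curve -/

namespace AdaptedCurve

variable {Y : Plane → Plane} {A : Plane →L[ℝ] Plane} {z₀ f : Plane} {τ : ℝ}
    {c : ℝ → Plane} {lam : ℝ → ℝ}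

theorem continuousAt_deriv (h : AdaptedCurve Y A z₀ f τ c lam) : ContinuousAt (deriv c) 0 := by
  have h1 : ContDiffAt ℝ 0 (deriv c) 0 := (h.smooth.of_le (m := 1) (by simp)).derivWithin (by simp)
  exact h1.continuousAt

theorem tendsto_curve (h : AdaptedCurve Y A z₀ f τ c lam) :
    Tendsto (fun w : Plane ↦ c (w 1)) (𝓝 0) (𝓝 z₀) := by
  have := h.smooth.continuousAt.tendsto.comp tendsto_coord_one
  rwa [h.start] at this

theorem tendsto_adaptedMap (h : AdaptedCurve Y A z₀ f τ c lam) :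
    Tendsto (adaptedMap c f) (𝓝 0) (𝓝 z₀) := by
  have := h.tendsto_curve.add (tendsto_coord_zero.smul_const f)
  rw [zero_smul, add_zero] at this
  exact this

/-- Strict differentiability compares the values of `Y` at `c(s) + x f` and at `c(s)` with an error
`o(|x|)`, which is absorbed into `v` after division by `x`. Plain differentiability at `z₀` would
only give an error relative to the distance to `z₀`, too coarse against `s^k`. -/
theorem eventually_field_eq (h : AdaptedCurve Y A z₀ f τ c lam) {ε : ℝ} (hε : 0 < ε) :
    ∀ᶠ w : Plane in 𝓝 0, ∃ v, ‖v - τ • f‖ < ε ∧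
      Y (adaptedMap c f w) = lam (w 1) • deriv c (w 1) + w 0 • v := by
  have hpos : 0 < ε / (‖f‖ + 1) := by positivity
  have hT : Tendsto (fun w : Plane ↦ (adaptedMap c f w, c (w 1))) (𝓝 0) (𝓝 (z₀, z₀)) :=
    h.tendsto_adaptedMap.prodMk_nhds h.tendsto_curve
  filter_upwards [hT.eventually (h.field.isLittleO.def hpos), tendsto_coord_one.eventually h.tangent]
    with w hw hw'
  simp only [hw', adaptedMap, add_sub_cancel_left, map_smul, h.eigen] at hw ⊢
  rcases eq_or_ne (w 0) 0 with h0 | h0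
  · exact ⟨τ • f, by simpa using hε, by simp [h0, hw']⟩
  refine ⟨(w 0)⁻¹ • (Y (c (w 1) + w 0 • f) - lam (w 1) • deriv c (w 1)), ?_, ?_⟩
  · have : (w 0)⁻¹ • (Y (c (w 1) + w 0 • f) - lam (w 1) • deriv c (w 1)) - τ • f =
        (w 0)⁻¹ • (Y (c (w 1) + w 0 • f) - lam (w 1) • deriv c (w 1) - w 0 • τ • f) := by
      rw [smul_sub _ _ (w 0 • τ • f), smul_smul, inv_mul_cancel₀ h0, one_smul]
    rw [this, norm_smul, norm_inv]
    have hn : 0 < ‖w 0‖ := norm_pos_iff.2 h0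
    rw [inv_mul_lt_iff₀ hn]
    refine hw.trans_lt ?_
    rw [norm_smul, div_mul_eq_mul_div, div_lt_iff₀ (by positivity)]
    have := mul_pos hε hn
    nlinarith [norm_nonneg f]
  · rw [smul_smul, mul_inv_cancel₀ h0, one_smul, add_sub_cancel]

/-- Lower bounds for determinants formed from vectors close to `e` and `τ f`. -/
theorem eventually_cross (h : AdaptedCurve Y A z₀ f τ c lam) :
    ∃ ε > 0, ∀ u v : Plane, ‖u - deriv c 0‖ < ε → ‖v - τ • f‖ < ε →
      0 < cross u v * (τ * cross (deriv c 0) f) ∧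
      |τ * cross (deriv c 0) f| / 2 ≤ |cross u v| ∧ ‖u‖ ≤ ‖deriv c 0‖ + 1 ∧ ‖v‖ ≤ ‖τ • f‖ + 1 := by
  set κ := τ * cross (deriv c 0) f with hκ
  have hκ0 : κ ≠ 0 := mul_ne_zero h.eigenvalue h.independent
  have hcont := continuous_cross.continuousAt (x := (deriv c 0, τ • f))
  -- A determinant within `|κ| / 2` of `κ` keeps its sign and at least half its size.
  obtain ⟨ε, hε, hb⟩ := Metric.continuousAt_iff.1 hcont (|κ| / 2) (by positivity)
  refine ⟨min ε 1, by positivity, fun u v hu hv ↦ ?_⟩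
  have h1 : dist (u, v) (deriv c 0, τ • f) < ε := by
    rw [Prod.dist_eq, dist_eq_norm, dist_eq_norm]
    exact max_lt (hu.trans_le (min_le_left _ _)) (hv.trans_le (min_le_left _ _))
  have h2 := hb h1
  simp only [cross_smul_right, ← hκ, Real.dist_eq] at h2
  refine ⟨?_, ?_, ?_, ?_⟩
  · rcases hκ0.lt_or_gt with h0 | h0
    · rw [abs_of_neg h0] at h2
      have := abs_lt.1 h2
      nlinarith
    · rw [abs_of_pos h0] at h2
      have := abs_lt.1 h2
      nlinarith
  · have := abs_sub_abs_le_abs_sub κ (cross u v)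
    rw [abs_sub_comm κ] at this
    linarith
  · have := norm_sub_norm_le u (deriv c 0)
    linarith [hu.trans_le (min_le_right _ _)]
  · have := norm_sub_norm_le v (τ • f)
    linarith [hv.trans_le (min_le_right _ _)]

theorem eventually_deriv (h : AdaptedCurve Y A z₀ f τ c lam) {ε : ℝ} (hε : 0 < ε) :
    ∀ᶠ w : Plane in 𝓝 0, ‖deriv c (w 1) - deriv c 0‖ < ε := by
  have := (h.continuousAt_deriv.tendsto.comp tendsto_coord_one).eventually
    (Metric.ball_mem_nhds _ hε)
  filter_upwards [this] with w hw
  simpa [dist_eq_norm] using hw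

/-- In the coordinates `(x, s)` the norm of the field is comparable to `√(x² + s²ᵏ)`. -/
theorem exists_norm_bounds (h : AdaptedCurve Y A z₀ f τ c lam) {k : ℕ} {l : ℝ → ℝ}
    (hl : ContinuousAt l 0) (hl0 : l 0 ≠ 0) (hlam : ∀ s, lam s = s ^ k * l s) :
    ∃ C > 0, ∀ᶠ w : Plane in 𝓝 0,
      C⁻¹ * √(w 0 ^ 2 + w 1 ^ (2 * k)) ≤ ‖Y (adaptedMap c f w)‖ ∧
      ‖Y (adaptedMap c f w)‖ ≤ C * √(w 0 ^ 2 + w 1 ^ (2 * k)) := by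
  obtain ⟨ε, hε, hcr⟩ := h.eventually_cross
  set d := |τ * cross (deriv c 0) f| / 2 with hd
  have hd0 : 0 < d := by
    have := abs_pos.2 (mul_ne_zero h.eigenvalue h.independent)
    positivity
  set R := ‖deriv c 0‖ + 1 + (‖τ • f‖ + 1) with hR
  have hR0 : 0 < R := by positivity
  have hlev : ∀ᶠ w : Plane in 𝓝 0, |l 0| / 2 ≤ |l (w 1)| ∧ |l (w 1)| ≤ 2 * |l 0| := by
    have h1 := (hl.abs.tendsto.comp tendsto_coord_one)
    have hp := abs_pos.2 hl0
    filter_upwards [h1.eventually (Icc_mem_nhds (a := |l 0| / 2) (b := 2 * |l 0|)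
      (by linarith) (by linarith))] with w hw using hw
  have hp := abs_pos.2 hl0
  set C := max (2 * R / d * (1 + 2 / |l 0|)) (R * (2 * |l 0| + 1)) with hC
  have hC0 : 0 < C := lt_max_of_lt_right (by positivity)
  refine ⟨C, hC0, ?_⟩
  filter_upwards [h.eventually_field_eq hε, h.eventually_deriv hε, hlev] with w ⟨v, hv, hY⟩ hu hl'
  obtain ⟨-, h1, h2, h3⟩ := hcr _ _ hu hv
  set u := deriv c (w 1)
  set W := Y (adaptedMap c f w) with hW
  set x := w 0
  set s := w 1
  have hsk : |lam s| = |s| ^ k * |l s| := by rw [hlam, abs_mul, abs_pow]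
  have hsq : √(x ^ 2 + s ^ (2 * k)) ≤ |x| + |s| ^ k := by
    rw [Real.sqrt_le_left (by positivity)]
    have : s ^ (2 * k) = (|s| ^ k) ^ 2 := by
      rw [← pow_mul, mul_comm k 2, pow_mul, pow_mul, sq_abs]
    rw [this, ← sq_abs x]
    nlinarith [mul_nonneg (abs_nonneg x) (pow_nonneg (abs_nonneg s) k)]
  have hx : |x| ≤ √(x ^ 2 + s ^ (2 * k)) := by
    apply Real.abs_le_sqrt
    rw [pow_mul]
    have : 0 ≤ (s ^ 2) ^ k := by positivity
    linarith
  have hs : |s| ^ k ≤ √(x ^ 2 + s ^ (2 * k)) := by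
    rw [← abs_pow]
    apply Real.abs_le_sqrt
    rw [← pow_mul, mul_comm k 2]
    nlinarith [sq_nonneg x]
  have h4 : ‖W‖ * ‖v‖ ≤ ‖W‖ * R := by gcongr; linarith [norm_nonneg (deriv c 0)]
  have h5 : ‖u‖ * ‖W‖ ≤ ‖W‖ * R := by rw [mul_comm]; gcongr; linarith [norm_nonneg (τ • f)]
  constructor
  -- The determinant with `v` removes the `x` term and isolates `lam s`; below, the determinant with
  -- `u` isolates `x`.
  · have hA : |lam s| * d ≤ 2 * (‖W‖ * R) := by
      have : cross W v = lam s * cross u v := by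
        rw [hY, cross_add_left, cross_smul_left, cross_smul_left, cross_self]; ring
      calc |lam s| * d ≤ |lam s| * |cross u v| := by gcongr
        _ = |cross W v| := by rw [this, abs_mul]
        _ ≤ _ := (abs_cross_le _ _).trans (by linarith)
    have hB : |x| * d ≤ 2 * (‖W‖ * R) := by
      have : cross u W = x * cross u v := by
        rw [hY, cross_add_right, cross_smul_right, cross_smul_right, cross_self]; ring
      calc |x| * d ≤ |x| * |cross u v| := by gcongr
        _ = |cross u W| := by rw [this, abs_mul]
        _ ≤ _ := (abs_cross_le _ _).trans (by linarith)
    have hA' : |s| ^ k ≤ 2 * R / d * (2 / |l 0|) * ‖W‖ := by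
      have : |s| ^ k * (|l 0| / 2) ≤ |lam s| := by rw [hsk]; gcongr; exact hl'.1
      have h6 : |s| ^ k * (|l 0| / 2) * d ≤ 2 * (‖W‖ * R) := le_trans (by gcongr) hA
      have h7 : 2 * R / d * (2 / |l 0|) * ‖W‖ = 2 * (‖W‖ * R) / ((|l 0| / 2) * d) := by
        field_simp
      rw [h7, le_div_iff₀ (by positivity)]
      linarith
    have hB' : |x| ≤ 2 * R / d * ‖W‖ := by
      have h7 : 2 * R / d * ‖W‖ = 2 * (‖W‖ * R) / d := by ring
      rw [h7, le_div_iff₀ hd0]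
      exact hB
    rw [inv_mul_le_iff₀ hC0]
    calc _ ≤ |x| + |s| ^ k := hsq
      _ ≤ 2 * R / d * ‖W‖ + 2 * R / d * (2 / |l 0|) * ‖W‖ := add_le_add hB' hA'
      _ = 2 * R / d * (1 + 2 / |l 0|) * ‖W‖ := by ring
      _ ≤ C * ‖W‖ := by gcongr; exact le_max_left _ _
  · calc ‖W‖ ≤ |lam s| * ‖u‖ + |x| * ‖v‖ := by
          rw [hY]
          refine (norm_add_le _ _).trans ?_
          rw [norm_smul, norm_smul, Real.norm_eq_abs, Real.norm_eq_abs]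
      _ ≤ |s| ^ k * (2 * |l 0|) * R + |x| * R := by
          rw [hsk]
          gcongr
          · exact hl'.2
          · linarith [norm_nonneg (τ • f)]
          · linarith [norm_nonneg (deriv c 0)]
      _ ≤ √(x ^ 2 + s ^ (2 * k)) * (2 * |l 0|) * R + √(x ^ 2 + s ^ (2 * k)) * R := by
          gcongr
      _ = R * (2 * |l 0| + 1) * √(x ^ 2 + s ^ (2 * k)) := by ring
      _ ≤ C * √(x ^ 2 + s ^ (2 * k)) := by gcongr; exact le_max_right _ _

/-- Near its zero, the field is never a nonpositive multiple of a linear field with the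
eigenvectors `f`, `e` and eigenvalues `τ`, `Λ`, if the order of degeneracy is odd. -/
theorem eventually_add_linear_ne_zero (h : AdaptedCurve Y A z₀ f τ c lam) {k : ℕ} (hk : Odd k)
    {l : ℝ → ℝ} (hl : ContinuousAt l 0) (hlam : ∀ s, lam s = s ^ k * l s) {Λ : ℝ}
    (hΛ : 0 < l 0 * Λ) {L : Plane →L[ℝ] Plane} (hLf : L f = τ • f)
    (hLe : L (deriv c 0) = Λ • deriv c 0) :
    ∀ᶠ w : Plane in 𝓝 0, w ≠ 0 → ∀ μ : ℝ, 0 ≤ μ →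
      Y (adaptedMap c f w) + μ • L (adaptedMap c f w - z₀) ≠ 0 := by
  obtain ⟨ε, hε, hcr⟩ := h.eventually_cross
  have hΛ0 : Λ ≠ 0 := by rintro rfl; simp at hΛ
  have hdc : DifferentiableAt ℝ c 0 := h.smooth.differentiableAt (by simp)
  have hslope : ∀ᶠ w : Plane in 𝓝 0, ‖Λ⁻¹ • L (dslope c 0 (w 1)) - deriv c 0‖ < ε := by
    -- The secant slope, extended by `c'(0)` at `s = 0`, makes `L (c(s) - z₀)` equal to `s Λ` times
    -- a vector close to `c'(0)`.
    have h1 : ContinuousAt (fun s ↦ Λ⁻¹ • L (dslope c 0 s)) 0 :=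
      ((L.continuous.continuousAt).comp (continuousAt_dslope_same.2 hdc)).const_smul Λ⁻¹
    have h2 := (h1.tendsto.comp tendsto_coord_one).eventually (Metric.ball_mem_nhds _ hε)
    filter_upwards [h2] with w hw
    simpa [dist_eq_norm, hLe, smul_smul, hΛ0] using hw
  have hlev : ∀ᶠ w : Plane in 𝓝 0, 0 < l (w 1) * Λ := by
    have h1 := ((hl.mul_const Λ).tendsto.comp tendsto_coord_one)
    exact h1.eventually (lt_mem_nhds hΛ)
  filter_upwards [h.eventually_field_eq hε, h.eventually_deriv hε, hslope, hlev]
    with w ⟨v, hv, hY⟩ hu hu' hl' hw μ hμ h0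
  set κ := τ * cross (deriv c 0) f
  set u := deriv c (w 1)
  set u' := Λ⁻¹ • L (dslope c 0 (w 1)) with hu'_def
  have hτf : ‖τ • f - τ • f‖ < ε := by simpa using hε
  have c11 := (hcr u v hu hv).1
  have c12 := (hcr u (τ • f) hu hτf).1
  have c21 := (hcr u' v hu' hv).1
  have c22 := (hcr u' (τ • f) hu' hτf).1
  obtain ⟨m, hm⟩ := hk
  -- Oddness gives `lam s = s Λ a` with `a ≥ 0`, so that the field and the linear field share the
  -- sign-changing factor `s Λ` along the curve.
  set a := w 1 ^ (2 * m) * (l (w 1) * Λ) / Λ ^ 2 with ha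
  have hYw : Y (adaptedMap c f w) + μ • L (adaptedMap c f w - z₀) =
      (w 1 * Λ) • (a • u + μ • u') + w 0 • (v + μ • τ • f) := by
    have h1 : adaptedMap c f w - z₀ = w 1 • dslope c 0 (w 1) + w 0 • f := by
      have := sub_smul_dslope c 0 (w 1)
      rw [sub_zero] at this
      rw [this, h.start, adaptedMap]
      abel
    have h2 : lam (w 1) = w 1 * Λ * a := by
      rw [hlam, hm, ha]
      field_simp
      ring
    rw [hY, h1, h2, map_add, map_smul, map_smul, hLf, hu'_def]
    simp only [smul_add, smul_smul]
    have h3 : w 1 * Λ * (μ * Λ⁻¹) = μ * w 1 := by field_simp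
    rw [h3]
    module
  rw [hYw] at h0
  set p := a • u + μ • u'
  set r := v + μ • τ • f
  have hp (q : Plane) : cross ((w 1 * Λ) • p + w 0 • r) q = 0 := by rw [h0, cross_zero_left]
  have e1 : w 1 * Λ * cross p r = 0 := by
    have := hp r
    rwa [cross_add_left, cross_smul_left, cross_smul_left, cross_self, mul_zero, add_zero] at this
  -- All four determinants on the right have the sign of `κ`, so with weights `a, μ ≥ 0` they cannot
  -- cancel.
  have hpr : cross p r * κ = a * (cross u v * κ) + a * μ * (cross u (τ • f) * κ) +
      μ * (cross u' v * κ) + μ * μ * (cross u' (τ • f) * κ) := by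
    simp only [p, r, cross_add_left, cross_add_right, cross_smul_left, cross_smul_right]
    ring
  have hs : w 1 = 0 := by
    by_contra hs
    have ha0 : 0 < a := by
      have : 0 < w 1 ^ (2 * m) := by rw [pow_mul]; positivity
      positivity
    have : 0 < cross p r * κ := by rw [hpr]; positivity
    have h3 : cross p r ≠ 0 := by intro h4; rw [h4, zero_mul] at this; exact lt_irrefl _ this
    exact mul_ne_zero (mul_ne_zero hs hΛ0) h3 e1
  -- For `s = 0` the vector `p` may vanish, so `u` takes its place.
  have hx : w 0 = 0 := by
    have e2 : cross u ((w 1 * Λ) • p + w 0 • r) = 0 := by rw [h0, cross_zero_right]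
    rw [hs, zero_mul, zero_smul, zero_add, cross_smul_right] at e2
    have h3 : 0 < cross u r * κ := by
      have : cross u r * κ = cross u v * κ + μ * (cross u (τ • f) * κ) := by
        simp only [r, cross_add_right, cross_smul_right]
        ring
      rw [this]; positivity
    rcases mul_eq_zero.1 e2 with h4 | h4
    · exact h4
    · rw [h4, zero_mul] at h3; exact absurd h3 (lt_irrefl _)
  exact hw (by ext j; fin_cases j <;> simp [hs, hx])

/-- Near its zero, the field is never a nonpositive multiple of a constant field in the direction
of the kernel, if the order of degeneracy is even. -/
theorem eventually_add_const_ne_zero (h : AdaptedCurve Y A z₀ f τ c lam) {k : ℕ} (hk : Even k)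
    {l : ℝ → ℝ} (hl : ContinuousAt l 0) (hlam : ∀ s, lam s = s ^ k * l s) {Λ : ℝ}
    (hΛ : 0 < l 0 * Λ) :
    ∀ᶠ w : Plane in 𝓝 0, w ≠ 0 → ∀ μ : ℝ, 0 ≤ μ →
      Y (adaptedMap c f w) + μ • Λ • deriv c 0 ≠ 0 := by
  obtain ⟨ε, hε, hcr⟩ := h.eventually_cross
  have hΛ0 : Λ ≠ 0 := by rintro rfl; simp at hΛ
  have hlev : ∀ᶠ w : Plane in 𝓝 0, 0 < l (w 1) * Λ := by
    have h1 := ((hl.mul_const Λ).tendsto.comp tendsto_coord_one)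
    exact h1.eventually (lt_mem_nhds hΛ)
  filter_upwards [h.eventually_field_eq hε, h.eventually_deriv hε, hlev]
    with w ⟨v, hv, hY⟩ hu hl' hw μ hμ h0
  set κ := τ * cross (deriv c 0) f
  set u := deriv c (w 1)
  have he : ‖deriv c 0 - deriv c 0‖ < ε := by simpa using hε
  have c1 := (hcr u v hu hv).1
  have c2 := (hcr (deriv c 0) v he hv).1
  obtain ⟨m, hm⟩ := hk
  -- Evenness gives `lam s = Λ a` with `a ≥ 0`: along the curve the field points to the same side
  -- before and after the zero.
  set a := (w 1 ^ m) ^ 2 * (l (w 1) * Λ) / Λ ^ 2 with ha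
  have hYw : Y (adaptedMap c f w) + μ • Λ • deriv c 0 =
      Λ • (a • u + μ • deriv c 0) + w 0 • v := by
    have h2 : lam (w 1) = Λ * a := by
      rw [hlam, hm, ha]
      field_simp
      ring
    rw [hY, h2]
    module
  rw [hYw] at h0
  have ha0 : 0 ≤ a := by positivity
  -- The determinant with `v` removes the `x` term and leaves two terms of equal sign, so each of
  -- them vanishes.
  have e1 : (a * cross u v + μ * cross (deriv c 0) v) = 0 := by
    have : cross (Λ • (a • u + μ • deriv c 0) + w 0 • v) v = 0 := by rw [h0, cross_zero_left]
    simp only [cross_add_left, cross_smul_left, cross_self, mul_zero, add_zero] at this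
    exact (mul_eq_zero.1 this).resolve_left hΛ0
  have e2 : a * (cross u v * κ) + μ * (cross (deriv c 0) v * κ) = 0 := by
    linear_combination κ * e1
  have h3 : a * (cross u v * κ) = 0 := by
    have := mul_nonneg ha0 c1.le
    have := mul_nonneg hμ c2.le
    linarith
  have h4 : μ = 0 := by
    rw [h3, zero_add] at e2
    exact (mul_eq_zero.1 e2).resolve_right c2.ne'
  have ha' : a = 0 := (mul_eq_zero.1 h3).resolve_right c1.ne'
  rw [ha', h4, zero_smul, zero_smul, add_zero, smul_zero, zero_add] at h0
  have hx : w 0 = 0 := by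
    rcases smul_eq_zero.1 h0 with h5 | h5
    · exact h5
    · rw [h5, cross_zero_right, zero_mul] at c1
      exact absurd c1 (lt_irrefl _)
  have hs : w 1 = 0 := by
    rw [ha, div_eq_zero_iff] at ha'
    rcases ha' with h5 | h5
    · rcases mul_eq_zero.1 h5 with h6 | h6
      · exact eq_zero_of_pow_eq_zero (eq_zero_of_pow_eq_zero h6)
      · exact absurd h6 hl'.ne'
    · exact absurd h5 (by positivity)
  exact hw (by ext j; fin_cases j <;> simp [hs, hx])

end AdaptedCurve

/-! ### Factoring out a power of the parameter -/

/-- A smooth function whose derivatives of order less than `k` vanish at `0` is `s ^ k` times a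
function continuous at `0`. -/
theorem exists_eq_pow_mul {g : ℝ → ℝ} (hg : ContDiffAt ℝ ∞ g 0) {k : ℕ}
    (hk : ∀ j < k, iteratedDeriv j g 0 = 0) :
    ∃ l : ℝ → ℝ, ContinuousAt l 0 ∧ l 0 = iteratedDeriv k g 0 / k.factorial ∧
      ∀ s, g s = s ^ k * l s := by
  set L := iteratedDeriv k g 0 / k.factorial with hL
  obtain ⟨r, hr, hgr⟩ : ∃ r > 0, ContDiffOn ℝ k g (Metric.ball 0 r) := by
    obtain ⟨u, hu, hgu⟩ := (hg.of_le (m := k) (by exact_mod_cast le_top)).contDiffOn le_rfl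
      (by simp)
    obtain ⟨r, hr, hru⟩ := Metric.mem_nhds_iff.1 hu
    exact ⟨r, hr, hgu.mono hru⟩
  have h0r : (0 : ℝ) ∈ Metric.ball (0 : ℝ) r := Metric.mem_ball_self hr
  have hT := taylor_isLittleO (convex_ball (0 : ℝ) r) h0r hgr
  have hpoly (x : ℝ) : taylorWithinEval g k (Metric.ball 0 r) 0 x = x ^ k * L := by
    rw [taylor_within_apply, Finset.sum_range_succ, Finset.sum_eq_zero]
    · rw [iteratedDerivWithin_of_isOpen Metric.isOpen_ball h0r, hL, sub_zero, smul_eq_mul]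
      ring
    · intro j hj
      rw [iteratedDerivWithin_of_isOpen Metric.isOpen_ball h0r, hk j (Finset.mem_range.1 hj),
        smul_zero]
  rw [Metric.isOpen_ball.nhdsWithin_eq h0r] at hT
  simp only [hpoly, sub_zero] at hT
  -- The value at `0` is the Taylor coefficient; the Peano remainder `o(s^k)` makes the quotient
  -- continuous there.
  refine ⟨Function.update (fun s ↦ g s / s ^ k) 0 L, ?_, by simp, ?_⟩
  · rw [continuousAt_update_same]
    have h1 := (hT.mono nhdsWithin_le_nhds).tendsto_div_nhds_zero (l := 𝓝[≠] 0)
    have h2 := h1.add_const L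
    rw [zero_add] at h2
    refine h2.congr' ?_
    filter_upwards [self_mem_nhdsWithin] with s hs
    have : s ^ k ≠ 0 := pow_ne_zero _ hs
    field_simp
    ring
  · intro s
    rcases eq_or_ne s 0 with rfl | hs
    · rcases Nat.eq_zero_or_pos k with rfl | hk0
      · simp [hL]
      · have := hk 0 hk0
        simp only [iteratedDeriv_zero] at this
        simp [this, hk0.ne']
    · have : s ^ k ≠ 0 := pow_ne_zero _ hs
      simp only [Function.update_of_ne hs]
      field_simp

/-! ### The index of a planar vector field -/

/-- `θ` is an angle of the nowhere vanishing loop `F : [0, 2π] → ℝ²`, of degree `m`. -/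
def IsAngle (θ : ℝ → ℝ) (F : ℝ → Plane) (m : ℤ) : Prop :=
  Continuous θ ∧
    (∀ t : ℝ, ∃ ρ : ℝ, 0 < ρ ∧ F t = ρ • !₂[Real.cos (θ t), Real.sin (θ t)]) ∧
    θ (2 * Real.pi) - θ 0 = m * (2 * Real.pi)

theorem exists_polar {v : Plane} (hv : v ≠ 0) :
    ∃ ρ θ : ℝ, 0 < ρ ∧ v = ρ • !₂[Real.cos θ, Real.sin θ] := by
  set z : ℂ := ⟨v 0, v 1⟩ with hz
  have hz0 : z ≠ 0 := by
    intro h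
    apply hv
    have h0 : v 0 = 0 := congrArg Complex.re h
    have h1 : v 1 = 0 := congrArg Complex.im h
    ext j; fin_cases j <;> simp [h0, h1]
  refine ⟨‖z‖, z.arg, norm_pos_iff.2 hz0, ?_⟩
  have h0 : ‖z‖ * Real.cos z.arg = v 0 := Complex.norm_mul_cos_arg z
  have h1 : ‖z‖ * Real.sin z.arg = v 1 := Complex.norm_mul_sin_arg z
  ext j; fin_cases j <;> simp [h0, h1]

/-- Two loops in the punctured plane which are never opposite have the same degree. -/
theorem IsAngle.exists_of_never_opposite {F G : ℝ → Plane} {θ : ℝ → ℝ} {m : ℤ}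
    (hθ : IsAngle θ G m) (hF : Continuous F) (hper : F (2 * Real.pi) = F 0)
    (hFG : ∀ t μ : ℝ, 0 ≤ μ → F t + μ • G t ≠ 0) : ∃ θ', IsAngle θ' F m := by
  obtain ⟨hc, hG, hm⟩ := hθ
  -- In complex notation `H = F · exp(-iθ)`: the loop `F` seen in the frame rotating with `G`.
  set H : ℝ → ℂ := fun t ↦ ⟨F t 0 * Real.cos (θ t) + F t 1 * Real.sin (θ t),
    F t 1 * Real.cos (θ t) - F t 0 * Real.sin (θ t)⟩ with hH
  have hF0 (t : ℝ) : F t 0 = (H t).re * Real.cos (θ t) - (H t).im * Real.sin (θ t) := by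
    simp only [hH]
    linear_combination -(F t 0) * Real.sin_sq_add_cos_sq (θ t)
  have hF1 (t : ℝ) : F t 1 = (H t).re * Real.sin (θ t) + (H t).im * Real.cos (θ t) := by
    simp only [hH]
    linear_combination -(F t 1) * Real.sin_sq_add_cos_sq (θ t)
  have hslit (t : ℝ) : H t ∈ Complex.slitPlane := by
    rw [Complex.mem_slitPlane_iff]
    by_contra! hcon
    obtain ⟨hre, him⟩ := hcon
    obtain ⟨ρ, hρ, hGt⟩ := hG t
    -- A nonpositive real value of `H t` would make `F t` zero or opposite to `G t`.
    apply hFG t (-(H t).re / ρ) (div_nonneg (by linarith) hρ.le)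
    have h0 := hF0 t
    have h1 := hF1 t
    rw [him] at h0 h1
    rw [hGt, smul_smul, div_mul_cancel₀ _ hρ.ne']
    ext j; fin_cases j <;> simp [h0, h1]
  have hHc : Continuous H := by
    have : H = fun t ↦ ((F t 0 * Real.cos (θ t) + F t 1 * Real.sin (θ t) : ℝ) : ℂ) +
        ((F t 1 * Real.cos (θ t) - F t 0 * Real.sin (θ t) : ℝ) : ℂ) * Complex.I := by
      funext t
      exact (Complex.mk_eq_add_mul_I _ _)
    rw [this]
    fun_prop
  refine ⟨fun t ↦ θ t + (H t).arg, ?_, ?_, ?_⟩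
  · refine hc.add (continuous_iff_continuousAt.2 fun t ↦ ?_)
    exact (Complex.continuousAt_arg (hslit t)).comp hHc.continuousAt
  · intro t
    refine ⟨‖H t‖, norm_pos_iff.2 (Complex.slitPlane_ne_zero (hslit t)), ?_⟩
    have h0 := Complex.norm_mul_cos_arg (H t)
    have h1 := Complex.norm_mul_sin_arg (H t)
    have hF0' := hF0 t
    have hF1' := hF1 t
    rw [← h0, ← h1] at hF0' hF1'
    ext j
    fin_cases j
    · simp only [Fin.zero_eta, PiLp.smul_apply, smul_eq_mul, Real.cos_add]
      rw [hF0']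
      simp only [Matrix.cons_val_zero]
      ring
    · simp only [Fin.mk_one, PiLp.smul_apply, smul_eq_mul, Real.sin_add]
      rw [hF1']
      simp only [Matrix.cons_val_one, Matrix.cons_val_fin_one]
      ring
  -- The angle `θ` changes by a multiple of `2π`, so `H` takes equal values at both ends and its
  -- argument adds nothing to the degree.
  · have h2 : θ (2 * Real.pi) = θ 0 + m * (2 * Real.pi) := by linarith
    have h3 : H (2 * Real.pi) = H 0 := by
      simp only [hH, h2, hper, Real.cos_add_int_mul_two_pi, Real.sin_add_int_mul_two_pi]
    simp only [h3, h2]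
    ring

/-- The degree of an invertible linear field on a circle is the sign of its determinant. -/
theorem exists_isAngle_linear (L : Plane →L[ℝ] Plane) {δ : ℝ} (hδ : δ ≠ 0)
    (hL : cross (L !₂[1, 0]) (L !₂[0, 1]) = δ) {r : ℝ} (hr : 0 < r) :
    ∃ θ, IsAngle θ (fun t ↦ L (r • !₂[Real.cos t, Real.sin t])) (SignType.sign δ : ℤ) := by
  set m₀ := L !₂[1, 0]
  set m₁ := L !₂[0, 1]
  have hLt (t : ℝ) : L (r • !₂[Real.cos t, Real.sin t]) =
      r • (Real.cos t • m₀ + Real.sin t • m₁) := by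
    rw [← map_smul L, ← map_smul L, ← map_add, ← map_smul L]
    congr 1
    ext j; fin_cases j <;> simp
  have hFc : Continuous fun t ↦ L (r • !₂[Real.cos t, Real.sin t]) := by
    simp only [hLt]; fun_prop
  have hper : L (r • !₂[Real.cos (2 * Real.pi), Real.sin (2 * Real.pi)]) =
      L (r • !₂[Real.cos 0, Real.sin 0]) := by simp
  -- Under `ℝ² = ℂ` the map is `L z = α z + β z̄`, with determinant `|α|² - |β|²`. The sign of the
  -- determinant decides which term dominates, and that term is the comparison loop, turning once.
  set α : Plane := !₂[(m₀ 0 + m₁ 1) / 2, (m₀ 1 - m₁ 0) / 2] with hα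
  set β : Plane := !₂[(m₀ 0 - m₁ 1) / 2, (m₀ 1 + m₁ 0) / 2] with hβ
  have hdet : (α 0 ^ 2 + α 1 ^ 2) - (β 0 ^ 2 + β 1 ^ 2) = δ := by
    rw [← hL]
    simp [hα, hβ, cross]
    ring
  have hL0 (t : ℝ) : (L (r • !₂[Real.cos t, Real.sin t])) 0 = r * ((α 0 * Real.cos t -
      α 1 * Real.sin t) + (β 0 * Real.cos t + β 1 * Real.sin t)) := by
    rw [hLt]; simp [hα, hβ]; ring
  have hL1 (t : ℝ) : (L (r • !₂[Real.cos t, Real.sin t])) 1 = r * ((α 0 * Real.sin t +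
      α 1 * Real.cos t) + (β 1 * Real.cos t - β 0 * Real.sin t)) := by
    rw [hLt]; simp [hα, hβ]; ring
  rcases hδ.lt_or_gt with hneg | hpos
  · rw [sign_neg hneg]
    have hβ0 : β ≠ 0 := by
      intro h
      simp only [h, PiLp.zero_apply] at hdet
      nlinarith [sq_nonneg (α 0), sq_nonneg (α 1)]
    obtain ⟨ρ, a, hρ, hβa⟩ := exists_polar hβ0
    have hβa0 : β 0 = ρ * Real.cos a := by rw [hβa]; simp
    have hβa1 : β 1 = ρ * Real.sin a := by rw [hβa]; simp
    have hG : IsAngle (fun t ↦ a - t) (fun t ↦ (r * ρ) • !₂[Real.cos (a - t), Real.sin (a - t)])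
        (-1) := by
      refine ⟨by fun_prop, fun t ↦ ⟨r * ρ, by positivity, rfl⟩, ?_⟩
      push_cast; ring
    refine hG.exists_of_never_opposite hFc hper fun t μ hμ h ↦ ?_
    have h0 := congrFun (congrArg (fun v : Plane ↦ (v : Fin 2 → ℝ)) h) 0
    have h1 := congrFun (congrArg (fun v : Plane ↦ (v : Fin 2 → ℝ)) h) 1
    simp only [PiLp.add_apply, PiLp.smul_apply, hL0, hL1, smul_eq_mul, PiLp.zero_apply,
      Matrix.cons_val_zero, Matrix.cons_val_one, Real.cos_sub, Real.sin_sub] at h0 h1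
    have h0' : (α 0 * Real.cos t - α 1 * Real.sin t) +
        (1 + μ) * (β 0 * Real.cos t + β 1 * Real.sin t) = 0 := by
      apply mul_left_cancel₀ hr.ne'
      rw [hβa0, hβa1] at h0 ⊢
      linear_combination h0
    have h1' : (α 0 * Real.sin t + α 1 * Real.cos t) +
        (1 + μ) * (β 1 * Real.cos t - β 0 * Real.sin t) = 0 := by
      apply mul_left_cancel₀ hr.ne'
      rw [hβa0, hβa1] at h1 ⊢
      linear_combination h1
    -- If `α z + (1 + μ) β z̄ = 0`, then comparing moduli contradicts `|α| < |β|`.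
    have h2 : (α 0 ^ 2 + α 1 ^ 2) = (1 + μ) ^ 2 * (β 0 ^ 2 + β 1 ^ 2) := by
      have e0 : (α 0 * Real.cos t - α 1 * Real.sin t) ^ 2 =
        ((1 + μ) * (β 0 * Real.cos t + β 1 * Real.sin t)) ^ 2 := by
        rw [eq_neg_of_add_eq_zero_left h0']; ring
      have e1 : (α 0 * Real.sin t + α 1 * Real.cos t) ^ 2 =
        ((1 + μ) * (β 1 * Real.cos t - β 0 * Real.sin t)) ^ 2 := by
        rw [eq_neg_of_add_eq_zero_left h1']; ring
      linear_combination e0 + e1 + ((1 + μ) ^ 2 * (β 0 ^ 2 + β 1 ^ 2) - (α 0 ^ 2 + α 1 ^ 2)) *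
        Real.sin_sq_add_cos_sq t
    nlinarith [sq_nonneg (β 0), sq_nonneg (β 1), mul_nonneg hμ (sq_nonneg (β 0)),
      mul_nonneg hμ (sq_nonneg (β 1)), mul_nonneg (mul_nonneg hμ hμ) (sq_nonneg (β 0)),
      mul_nonneg (mul_nonneg hμ hμ) (sq_nonneg (β 1))]
  · rw [sign_pos hpos]
    have hα0 : α ≠ 0 := by
      intro h
      simp only [h, PiLp.zero_apply] at hdet
      nlinarith [sq_nonneg (β 0), sq_nonneg (β 1)]
    obtain ⟨ρ, a, hρ, hαa⟩ := exists_polar hα0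
    have hαa0 : α 0 = ρ * Real.cos a := by rw [hαa]; simp
    have hαa1 : α 1 = ρ * Real.sin a := by rw [hαa]; simp
    have hG : IsAngle (fun t ↦ a + t) (fun t ↦ (r * ρ) • !₂[Real.cos (a + t), Real.sin (a + t)])
        1 := by
      refine ⟨by fun_prop, fun t ↦ ⟨r * ρ, by positivity, rfl⟩, ?_⟩
      push_cast; ring
    refine hG.exists_of_never_opposite hFc hper fun t μ hμ h ↦ ?_
    have h0 := congrFun (congrArg (fun v : Plane ↦ (v : Fin 2 → ℝ)) h) 0
    have h1 := congrFun (congrArg (fun v : Plane ↦ (v : Fin 2 → ℝ)) h) 1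
    simp only [PiLp.add_apply, PiLp.smul_apply, hL0, hL1, smul_eq_mul, PiLp.zero_apply,
      Matrix.cons_val_zero, Matrix.cons_val_one, Real.cos_add, Real.sin_add] at h0 h1
    have h0' : (1 + μ) * (α 0 * Real.cos t - α 1 * Real.sin t) +
        (β 0 * Real.cos t + β 1 * Real.sin t) = 0 := by
      apply mul_left_cancel₀ hr.ne'
      rw [hαa0, hαa1] at h0 ⊢
      linear_combination h0
    have h1' : (1 + μ) * (α 0 * Real.sin t + α 1 * Real.cos t) +
        (β 1 * Real.cos t - β 0 * Real.sin t) = 0 := by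
      apply mul_left_cancel₀ hr.ne'
      rw [hαa0, hαa1] at h1 ⊢
      linear_combination h1
    have h2 : (1 + μ) ^ 2 * (α 0 ^ 2 + α 1 ^ 2) = (β 0 ^ 2 + β 1 ^ 2) := by
      have e0 : (β 0 * Real.cos t + β 1 * Real.sin t) ^ 2 =
        ((1 + μ) * (α 0 * Real.cos t - α 1 * Real.sin t)) ^ 2 := by
        rw [eq_neg_of_add_eq_zero_right h0']; ring
      have e1 : (β 1 * Real.cos t - β 0 * Real.sin t) ^ 2 =
        ((1 + μ) * (α 0 * Real.sin t + α 1 * Real.cos t)) ^ 2 := by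
        rw [eq_neg_of_add_eq_zero_right h1']; ring
      linear_combination -e0 - e1 + ((β 0 ^ 2 + β 1 ^ 2) - (1 + μ) ^ 2 * (α 0 ^ 2 + α 1 ^ 2)) *
        Real.sin_sq_add_cos_sq t
    nlinarith [sq_nonneg (α 0), sq_nonneg (α 1), mul_nonneg hμ (sq_nonneg (α 0)),
      mul_nonneg hμ (sq_nonneg (α 1)), mul_nonneg (mul_nonneg hμ hμ) (sq_nonneg (α 0)),
      mul_nonneg (mul_nonneg hμ hμ) (sq_nonneg (α 1))]

/-- If `Y` is never opposite to a field `G` near `z₀` then `Y` has the degree of `G` on all small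
circles around `z₀`. -/
theorem eventually_isAngle {Y G : Plane → Plane} {z₀ : Plane} {m : ℤ}
    (hY : ∀ᶠ z in 𝓝 z₀, ContinuousAt Y z)
    (hG : ∀ r : ℝ, 0 < r → ∃ θ, IsAngle θ (fun t ↦ G (r • !₂[Real.cos t, Real.sin t])) m)
    (hYG : ∀ᶠ z in 𝓝[≠] z₀, ∀ μ : ℝ, 0 ≤ μ → Y z + μ • G (z - z₀) ≠ 0) :
    ∀ᶠ r in 𝓝[>] (0 : ℝ), ∃ θ, IsAngle θ (fun t ↦ Y (z₀ + r • !₂[Real.cos t, Real.sin t])) m := by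
  rw [eventually_nhdsWithin_iff] at hYG
  obtain ⟨R, hR, hball⟩ := Metric.eventually_nhds_iff.1 (hY.and hYG)
  filter_upwards [Ioo_mem_nhdsGT hR] with r ⟨hr0, hrR⟩
  have hnorm (t : ℝ) : ‖(!₂[Real.cos t, Real.sin t] : Plane)‖ = 1 := by
    rw [EuclideanSpace.norm_eq]
    simp
  have hdist (t : ℝ) : dist (z₀ + r • !₂[Real.cos t, Real.sin t]) z₀ = r := by
    rw [dist_eq_norm, add_sub_cancel_left, norm_smul, hnorm, mul_one, Real.norm_of_nonneg hr0.le]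
  have hpt (t : ℝ) := hball (y := z₀ + r • !₂[Real.cos t, Real.sin t]) (by rwa [hdist])
  obtain ⟨θ, hθ⟩ := hG r hr0
  refine hθ.exists_of_never_opposite ?_ (by simp) fun t μ hμ ↦ ?_
  · refine continuous_iff_continuousAt.2 fun t ↦ ?_
    refine ContinuousAt.comp (g := Y) (f := fun t ↦ z₀ + r • !₂[Real.cos t, Real.sin t])
      (hpt t).1 ?_
    have : (fun t ↦ z₀ + r • (!₂[Real.cos t, Real.sin t] : Plane)) = fun t ↦
        z₀ + r • (Real.cos t • !₂[1, 0] + Real.sin t • !₂[0, 1]) := by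
      funext t
      congr 2
      ext j; fin_cases j <;> simp
    rw [this]
    fun_prop
  · have := (hpt t).2 (by
      intro h
      have h1 := hdist t
      rw [mem_singleton_iff.1 h, dist_self] at h1
      exact hr0.ne h1) μ hμ
    rwa [add_sub_cancel_left] at this

/-! ### Consequences for adapted curves -/

namespace AdaptedCurve

variable {Y : Plane → Plane} {A : Plane →L[ℝ] Plane} {z₀ f : Plane} {τ : ℝ}
    {c : ℝ → Plane} {lam : ℝ → ℝ}

theorem hasFDerivAt_adaptedMap {w : Plane} (hc : DifferentiableAt ℝ c (w 1)) :
    HasFDerivAt (adaptedMap c f)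
      ((EuclideanSpace.proj (1 : Fin 2) : Plane →L[ℝ] ℝ).smulRight (deriv c (w 1)) +
        (EuclideanSpace.proj (0 : Fin 2) : Plane →L[ℝ] ℝ).smulRight f) w := by
  have h1 : HasFDerivAt (fun w : Plane ↦ w 1) (EuclideanSpace.proj (1 : Fin 2) : Plane →L[ℝ] ℝ) w :=
    (EuclideanSpace.proj (1 : Fin 2) : Plane →L[ℝ] ℝ).hasFDerivAt
  have h0 : HasFDerivAt (fun w : Plane ↦ w 0) (EuclideanSpace.proj (0 : Fin 2) : Plane →L[ℝ] ℝ) w :=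
    (EuclideanSpace.proj (0 : Fin 2) : Plane →L[ℝ] ℝ).hasFDerivAt
  have h2 : HasFDerivAt (fun w : Plane ↦ c (w 1)) ((EuclideanSpace.proj (1 : Fin 2) :
      Plane →L[ℝ] ℝ).smulRight (deriv c (w 1))) w :=
    (hc.hasDerivAt.hasFDerivAt.comp w h1).congr_fderiv (by ext v; simp)
  exact h2.add (h0.smul_const f)

/-- The map `(x, s) ↦ c(s) + x f` is a local diffeomorphism. -/
theorem exists_openPartialHomeomorph (h : AdaptedCurve Y A z₀ f τ c lam)
    (hc : ∀ᶠ s in 𝓝 0, ContDiffAt ℝ ∞ c s) {p : Plane → Prop} (hp : ∀ᶠ w in 𝓝 0, p w) :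
    ∃ ψ : OpenPartialHomeomorph Plane Plane, (∀ w, ψ w = adaptedMap c f w) ∧ 0 ∈ ψ.source ∧
      (∀ w ∈ ψ.source, p w) ∧ ContDiffOn ℝ ∞ ψ ψ.source ∧ ContDiffOn ℝ ∞ ψ.symm ψ.target := by
  set D : Plane → (Plane →L[ℝ] Plane) := fun w ↦
    (EuclideanSpace.proj (1 : Fin 2) : Plane →L[ℝ] ℝ).smulRight (deriv c (w 1)) +
        (EuclideanSpace.proj (0 : Fin 2) : Plane →L[ℝ] ℝ).smulRight f with hD
  have hDapp (w v : Plane) : D w v = v 1 • deriv c (w 1) + v 0 • f := rfl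
  have hcd : ∀ w : Plane, ContDiffAt ℝ ∞ c (w 1) → ContDiffAt ℝ ∞ (adaptedMap c f) w := by
    intro w hw
    have h1 : ContDiffAt ℝ ∞ (fun w : Plane ↦ c (w 1)) w :=
      ContDiffAt.comp w hw (by fun_prop)
    exact h1.add (by fun_prop)
  have hequiv (w : Plane) (hw : cross (deriv c (w 1)) f ≠ 0) :
      ∃ e : Plane ≃L[ℝ] Plane, (e : Plane →L[ℝ] Plane) = D w := by
    have hinj : Function.Injective (D w : Plane →ₗ[ℝ] Plane) := by
      rw [← LinearMap.ker_eq_bot, LinearMap.ker_eq_bot']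
      intro v hv
      have hv' : v 1 • deriv c (w 1) + v 0 • f = 0 := hv
      have h1 : v 1 * cross (deriv c (w 1)) f = 0 := by
        have : cross (v 1 • deriv c (w 1) + v 0 • f) f = 0 := by rw [hv', cross_zero_left]
        simpa only [cross_add_left, cross_smul_left, cross_self, mul_zero, add_zero] using this
      have h0 : v 0 * cross (deriv c (w 1)) f = 0 := by
        have : cross (deriv c (w 1)) (v 1 • deriv c (w 1) + v 0 • f) = 0 := by
          rw [hv', cross_zero_right]
        simpa only [cross_add_right, cross_smul_right, cross_self, mul_zero, zero_add] using this
      have h1' := (mul_eq_zero.1 h1).resolve_right hw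
      have h0' := (mul_eq_zero.1 h0).resolve_right hw
      ext j; fin_cases j <;> simp [h0', h1']
    refine ⟨(LinearEquiv.ofInjectiveEndo _ hinj).toContinuousLinearEquiv, ?_⟩
    ext1 v
    rfl
  obtain ⟨e, he⟩ := hequiv 0 h.independent
  have hder : HasFDerivAt (adaptedMap c f) (e : Plane →L[ℝ] Plane) 0 := by
    rw [he]
    exact hasFDerivAt_adaptedMap (h.smooth.differentiableAt (by simp))
  have hcd0 : ContDiffAt ℝ ∞ (adaptedMap c f) 0 := hcd 0 h.smooth
  set ψ₀ := hcd0.toOpenPartialHomeomorph (adaptedMap c f) hder (by simp) with hψ₀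
  have hψ₀c : ∀ w, ψ₀ w = adaptedMap c f w := fun w ↦ rfl
  have hcross : ∀ᶠ w : Plane in 𝓝 0, cross (deriv c (w 1)) f ≠ 0 := by
    have h1 : ContinuousAt (fun s ↦ cross (deriv c s) f) 0 :=
      ContinuousAt.comp (f := fun s ↦ (deriv c s, f)) continuous_cross.continuousAt
        (h.continuousAt_deriv.prodMk continuousAt_const)
    exact (h1.tendsto.comp tendsto_coord_one).eventually_ne h.independent
  -- On `U` the curve is smooth and the differential stays invertible, so the inverse is smooth on
  -- the whole target and not merely at the image of `0`; the property `p` is secured on `U` as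
  -- well.
  obtain ⟨U, hU, hUo, h0U⟩ := eventually_nhds_iff.1
    ((tendsto_coord_one.eventually hc).and (hcross.and hp))
  refine ⟨ψ₀.restrOpen U hUo, fun w ↦ rfl, ⟨?_, h0U⟩, fun w hw ↦ (hU w hw.2).2.2, ?_, ?_⟩
  · exact hcd0.mem_toOpenPartialHomeomorph_source hder (by simp)
  · exact fun w hw ↦ (hcd w (hU w hw.2).1).contDiffWithinAt
  · intro z hz
    have hw : (ψ₀.restrOpen U hUo).symm z ∈ (ψ₀.restrOpen U hUo).source :=
      (ψ₀.restrOpen U hUo).map_target hz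
    obtain ⟨hw1, hw2, -⟩ := hU _ hw.2
    obtain ⟨e', he'⟩ := hequiv _ hw2
    refine (OpenPartialHomeomorph.contDiffAt_symm _ hz (f₀' := e') ?_ (hcd _ hw1)).contDiffWithinAt
    rw [he']
    exact hasFDerivAt_adaptedMap (hw1.differentiableAt (by simp))

/-- A property of the points `c(s) + x f` for small `(x, s)` holds near `z₀`. -/
theorem eventually_punctured (h : AdaptedCurve Y A z₀ f τ c lam)
    (hc : ∀ᶠ s in 𝓝 0, ContDiffAt ℝ ∞ c s) {p : Plane → Prop}
    (hp : ∀ᶠ w : Plane in 𝓝 0, w ≠ 0 → p (adaptedMap c f w)) : ∀ᶠ z in 𝓝[≠] z₀, p z := by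
  obtain ⟨ψ, hψ, h0, hψp, -, -⟩ := h.exists_openPartialHomeomorph hc hp
  have hz₀ : ψ 0 = z₀ := by rw [hψ, adaptedMap]; simp [h.start]
  have ht : ψ.target ∈ 𝓝 z₀ := ψ.open_target.mem_nhds (hz₀ ▸ ψ.map_source h0)
  filter_upwards [nhdsWithin_le_nhds ht, self_mem_nhdsWithin] with z hz hne
  have h1 := hψp _ (ψ.map_target hz) (by
    intro h2
    apply hne
    rw [mem_singleton_iff, ← ψ.right_inv hz, h2, hz₀])
  rwa [← hψ, ψ.right_inv hz] at h1

theorem eventually_near (h : AdaptedCurve Y A z₀ f τ c lam)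
    (hc : ∀ᶠ s in 𝓝 0, ContDiffAt ℝ ∞ c s) {p : Plane → Prop}
    (hp : ∀ᶠ w : Plane in 𝓝 0, p (adaptedMap c f w)) : ∀ᶠ z in 𝓝 z₀, p z := by
  have h1 := h.eventually_punctured hc (hp.mono fun w hw _ ↦ hw)
  have h2 : p z₀ := by
    have := hp.self_of_nhds
    rw [adaptedMap] at this
    simpa [h.start] using this
  rw [eventually_nhdsWithin_iff] at h1
  filter_upwards [h1] with z hz
  rcases eq_or_ne z z₀ with rfl | hne
  · exact h2
  · exact hz hne

/-- The factor `lam` is an arbitrary function in `AdaptedCurve`; its smoothness is recovered from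
the quotient `cross (Y (c s)) f / cross (c' s) f`, whose denominator is non-zero at `0`. -/
theorem contDiffAt_lam (h : AdaptedCurve Y A z₀ f τ c lam) (hY : ContDiffAt ℝ ∞ Y z₀) :
    ContDiffAt ℝ ∞ lam 0 := by
  have hcr (u : ℝ → Plane) (hu : ContDiffAt ℝ ∞ u 0) : ContDiffAt ℝ ∞ (fun s ↦ cross (u s) f) 0 := by
    unfold cross
    fun_prop
  have h1 : ContDiffAt ℝ ∞ (fun s ↦ Y (c s)) 0 :=
    ContDiffAt.comp (g := Y) 0 (by rwa [h.start]) h.smooth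
  have h2 : ContDiffAt ℝ ∞ (deriv c) 0 := h.smooth.derivWithin (by simp)
  refine ((hcr _ h1).div (hcr _ h2) h.independent).congr_of_eventuallyEq ?_
  have h3 := (hcr _ h2).continuousAt.eventually_ne h.independent
  filter_upwards [h.tangent, h3] with s hs hs'
  rw [Pi.div_apply, hs, cross_smul_left, mul_div_cancel_right₀ _ hs']

/-- The norm of the field along a curve whose velocity is not an eigenvector. -/
theorem exists_lower_bound_along (h : AdaptedCurve Y A z₀ f τ c lam)
    (hc : ∀ᶠ s in 𝓝 0, ContDiffAt ℝ ∞ c s) {k : ℕ} {l : ℝ → ℝ}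
    (hl : ContinuousAt l 0) (hl0 : l 0 ≠ 0) (hlam : ∀ s, lam s = s ^ k * l s)
    {c' : ℝ → Plane} (hc' : DifferentiableAt ℝ c' 0) (hc'0 : c' 0 = z₀)
    (hcr : cross (deriv c' 0) f ≠ 0) :
    ∃ b > 0, ∀ᶠ t in 𝓝 0, b * |t| ^ k ≤ ‖Y (c' t)‖ := by
  obtain ⟨C, hC, hb⟩ := h.exists_norm_bounds hl hl0 hlam
  -- The functional `cross · f` forgets the direction `f`: at `c(s) + x f` it depends on `s` only.
  -- It therefore bounds `|s|` from below without inverting the coordinate map.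
  have hφ (γ : ℝ → Plane) (hγ : DifferentiableAt ℝ γ 0) :
      HasDerivAt (fun s ↦ cross (γ s) f) (cross (deriv γ 0) f) 0 := by
    have h0 := (EuclideanSpace.proj (0 : Fin 2) : Plane →L[ℝ] ℝ).hasFDerivAt.comp_hasDerivAt 0
      hγ.hasDerivAt
    have h1 := (EuclideanSpace.proj (1 : Fin 2) : Plane →L[ℝ] ℝ).hasFDerivAt.comp_hasDerivAt 0
      hγ.hasDerivAt
    exact (h0.mul_const (f 1)).sub (h1.mul_const (f 0))
  set K := |cross (deriv c 0) f| + 1 with hK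
  have hK0 : 0 < K := by positivity
  have hup : ∀ᶠ s in 𝓝 (0 : ℝ), |cross (c s) f - cross z₀ f| ≤ K * |s| := by
    have h1 := (hφ c (h.smooth.differentiableAt (by simp))).isLittleO.def (c := 1) one_pos
    filter_upwards [h1] with s hs
    simp only [h.start, sub_zero, smul_eq_mul, Real.norm_eq_abs, one_mul] at hs
    calc |cross (c s) f - cross z₀ f| = |(cross (c s) f - cross z₀ f - s * cross (deriv c 0) f) +
          s * cross (deriv c 0) f| := by ring_nf
      _ ≤ |s| + |s * cross (deriv c 0) f| := (abs_add_le _ _).trans (by gcongr)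
      _ = K * |s| := by rw [abs_mul, hK]; ring
  have hlow : ∀ᶠ t in 𝓝 (0 : ℝ), |cross (deriv c' 0) f| / 2 * |t| ≤ |cross (c' t) f - cross z₀ f| := by
    have h1 := (hφ c' hc').isLittleO.def (c := |cross (deriv c' 0) f| / 2)
      (by have := abs_pos.2 hcr; positivity)
    filter_upwards [h1] with t ht
    simp only [hc'0, sub_zero, smul_eq_mul, Real.norm_eq_abs] at ht
    have h2 := abs_sub_abs_le_abs_sub (t * cross (deriv c' 0) f) (cross (c' t) f - cross z₀ f)
    rw [abs_sub_comm (t * cross (deriv c' 0) f), abs_mul] at h2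
    linarith
  have hnear : ∀ᶠ z in 𝓝 z₀, |cross z f - cross z₀ f| ^ k ≤ K ^ k * (C * ‖Y z‖) := by
    refine h.eventually_near hc ?_
    filter_upwards [hb, tendsto_coord_one.eventually hup] with w ⟨hw, _⟩ hs
    have h1 : cross (adaptedMap c f w) f = cross (c (w 1)) f := by
      rw [adaptedMap, cross_add_left, cross_smul_left, cross_self, mul_zero, add_zero]
    rw [inv_mul_le_iff₀ hC] at hw
    rw [h1]
    have h2 : |w 1| ^ k ≤ √(w 0 ^ 2 + w 1 ^ (2 * k)) := by
      rw [← abs_pow]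
      apply Real.abs_le_sqrt
      rw [← pow_mul, mul_comm k 2]
      nlinarith [sq_nonneg (w 0)]
    calc |cross (c (w 1)) f - cross z₀ f| ^ k ≤ (K * |w 1|) ^ k := by gcongr
      _ = K ^ k * |w 1| ^ k := mul_pow _ _ _
      _ ≤ _ := by gcongr; exact h2.trans hw
  set a := |cross (deriv c' 0) f| / 2
  have ha : 0 < a := by have := abs_pos.2 hcr; positivity
  refine ⟨a ^ k / (K ^ k * C), by positivity, ?_⟩
  have hc't : Tendsto c' (𝓝 0) (𝓝 z₀) := by
    have := hc'.continuousAt.tendsto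
    rwa [hc'0] at this
  filter_upwards [hlow, hc't.eventually hnear] with t h1 h2
  rw [div_mul_eq_mul_div, div_le_iff₀ (by positivity)]
  calc a ^ k * |t| ^ k = (a * |t|) ^ k := (mul_pow _ _ _).symm
    _ ≤ |cross (c' t) f - cross z₀ f| ^ k := by gcongr
    _ ≤ _ := h2.trans (by linarith)

/-- The order of vanishing does not depend on the adapted curve. -/
theorem exists_iteratedDeriv_ne_zero (h : AdaptedCurve Y A z₀ f τ c lam)
    (hY : ContDiffAt ℝ ∞ Y z₀)
    (hc : ∀ᶠ s in 𝓝 0, ContDiffAt ℝ ∞ c s) {k : ℕ} (hk : VanishesToOrder lam k)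
    {c' : ℝ → Plane} {lam' : ℝ → ℝ} (h' : AdaptedCurve Y A z₀ f τ c' lam') :
    ∃ j ≤ k, iteratedDeriv j lam' 0 ≠ 0 := by
  by_contra! hcon
  obtain ⟨l, hl, hl0, hlam⟩ := exists_eq_pow_mul (h.contDiffAt_lam hY) (k := k)
    (fun j hj ↦ by by_contra hne; exact absurd (hk.2 hne) (not_le.2 hj))
  have hl0' : l 0 ≠ 0 := by
    rw [hl0]; exact div_ne_zero hk.1 (by positivity)
  -- If all derivatives up to order `k` vanished, then `lam' t = t^k l'(t)` with `l'(0) = 0`, which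
  -- contradicts the lower bound `b |t|^k` for the norm of `Y` along `c'`.
  obtain ⟨l', hl', hl'0, hlam'⟩ := exists_eq_pow_mul (h'.contDiffAt_lam hY) (k := k)
    (fun j hj ↦ hcon j hj.le)
  rw [hcon k le_rfl, zero_div] at hl'0
  obtain ⟨b, hb, hbound⟩ := h.exists_lower_bound_along hc hl hl0' hlam
    (h'.smooth.differentiableAt (by simp)) h'.start h'.independent
  set R := ‖deriv c' 0‖ + 1 with hR
  have hR0 : 0 < R := by positivity
  have h1 : ∀ᶠ t in 𝓝 (0 : ℝ), |l' t| < b / R := by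
    have := hl'.abs.tendsto
    rw [hl'0, abs_zero] at this
    exact this.eventually (gt_mem_nhds (by positivity))
  have h2 : ∀ᶠ t in 𝓝 (0 : ℝ), ‖deriv c' t‖ < R :=
    h'.continuousAt_deriv.norm.tendsto.eventually (gt_mem_nhds (by linarith))
  have h3 : ∀ᶠ t in 𝓝[≠] (0 : ℝ), False := by
    filter_upwards [nhdsWithin_le_nhds h1, nhdsWithin_le_nhds h2, nhdsWithin_le_nhds hbound,
      nhdsWithin_le_nhds h'.tangent, self_mem_nhdsWithin] with t t1 t2 t3 t4 t5
    have ht : 0 < |t| ^ k := pow_pos (abs_pos.2 t5) _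
    rw [t4, norm_smul, hlam', Real.norm_eq_abs, abs_mul, abs_pow] at t3
    have t6 : |l' t| * ‖deriv c' t‖ < b := by
      rw [lt_div_iff₀ hR0] at t1
      refine lt_of_le_of_lt ?_ t1
      gcongr
    nlinarith
  exact h3.exists.choose_spec

/-- The preceding inequality between the orders applies in both directions: it first shows that the
order of `lam'` is finite, after which the two curves can exchange roles. -/
theorem vanishesToOrder (h : AdaptedCurve Y A z₀ f τ c lam)
    (hY : ContDiffAt ℝ ∞ Y z₀)
    (hc : ∀ᶠ s in 𝓝 0, ContDiffAt ℝ ∞ c s) {k : ℕ} (hk : VanishesToOrder lam k)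
    {c' : ℝ → Plane} {lam' : ℝ → ℝ} (h' : AdaptedCurve Y A z₀ f τ c' lam')
    (hc' : ∀ᶠ s in 𝓝 0, ContDiffAt ℝ ∞ c' s) : VanishesToOrder lam' k := by
  obtain ⟨j, hj, hne⟩ := h.exists_iteratedDeriv_ne_zero hY hc hk h'
  classical
  have hex : ∃ j, iteratedDeriv j lam' 0 ≠ 0 := ⟨j, hne⟩
  have hk' : VanishesToOrder lam' (Nat.find hex) :=
    ⟨Nat.find_spec hex, fun i hi ↦ Nat.find_min' hex hi⟩
  obtain ⟨j', hj', hne'⟩ := h'.exists_iteratedDeriv_ne_zero hY hc' hk' h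
  have h1 : k ≤ Nat.find hex := (hk.2 hne').trans hj'
  have h2 : Nat.find hex ≤ k := (Nat.find_min' hex hne).trans hj
  rwa [le_antisymm h2 h1] at hk'

/-- The index for odd orders of degeneracy. -/
theorem index_of_odd (h : AdaptedCurve Y A z₀ f τ c lam) (hY : ContDiffAt ℝ ∞ Y z₀)
    (hc : ∀ᶠ s in 𝓝 0, ContDiffAt ℝ ∞ c s) {k : ℕ} (hk : VanishesToOrder lam k) (hodd : Odd k) :
    ∀ᶠ r in 𝓝[>] (0 : ℝ), ∃ θ, IsAngle θ (fun t ↦ Y (z₀ + r • !₂[Real.cos t, Real.sin t]))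
      (SignType.sign (τ * iteratedDeriv k lam 0) : ℤ) := by
  obtain ⟨l, hl, hl0, hlam⟩ := exists_eq_pow_mul (h.contDiffAt_lam hY) (k := k)
    (fun j hj ↦ by by_contra hne; exact absurd (hk.2 hne) (not_le.2 hj))
  set Λ := iteratedDeriv k lam 0
  have hΛ : Λ ≠ 0 := hk.1
  have hpos : 0 < l 0 * Λ := by
    rw [hl0, div_mul_eq_mul_div, ← sq]
    positivity
  set e := deriv c 0
  set d := cross e f
  have hd : d ≠ 0 := h.independent
  -- Cramer's rule writes down the linear field with eigenvectors `e`, `f` and eigenvalues `Λ`, `τ`.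
  have hlin : IsLinearMap ℝ fun z : Plane ↦ d⁻¹ • ((cross z f * Λ) • e + (cross e z * τ) • f) := by
    constructor
    · intro x y
      rw [cross_add_left, cross_add_right]
      module
    · intro a x
      rw [cross_smul_left, cross_smul_right]
      module
  set L : Plane →L[ℝ] Plane := (hlin.mk' _).toContinuousLinearMap
  have hL (z : Plane) : L z = d⁻¹ • ((cross z f * Λ) • e + (cross e z * τ) • f) := rfl
  have hLf : L f = τ • f := by
    rw [hL, cross_self, zero_mul, zero_smul, zero_add, smul_smul]
    congr 1
    field_simp
    rfl
  have hLe : L e = Λ • e := by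
    rw [hL, cross_self, zero_mul, zero_smul, add_zero, smul_smul]
    congr 1
    field_simp
    rfl
  have hdet : cross (L !₂[1, 0]) (L !₂[0, 1]) = τ * Λ := by
    rw [hL, hL]
    simp only [cross_smul_left, cross_smul_right, cross_add_left, cross_add_right, cross_self]
    rw [cross_swap f e]
    have hd' : d = e 0 * f 1 - e 1 * f 0 := rfl
    have h1 : cross !₂[1, 0] f = f 1 := by simp [cross]
    have h2 : cross !₂[0, 1] f = -f 0 := by simp [cross]
    have h3 : cross e !₂[1, 0] = -e 1 := by simp [cross]
    have h4 : cross e !₂[0, 1] = e 0 := by simp [cross]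
    rw [h1, h2, h3, h4, show cross e f = d from rfl]
    field_simp
    rw [hd']
    ring
  refine eventually_isAngle (G := L) ?_ (fun r hr ↦ exists_isAngle_linear L
    (mul_ne_zero h.eigenvalue hΛ) hdet hr) ?_
  · filter_upwards [(hY.of_le (m := 1) (by simp)).eventually (by simp)] with z hz
    exact hz.continuousAt
  · exact h.eventually_punctured hc (h.eventually_add_linear_ne_zero hodd hl hlam hpos hLf hLe)

/-- The index for even orders of degeneracy. -/
theorem index_of_even (h : AdaptedCurve Y A z₀ f τ c lam) (hY : ContDiffAt ℝ ∞ Y z₀)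
    (hc : ∀ᶠ s in 𝓝 0, ContDiffAt ℝ ∞ c s) {k : ℕ} (hk : VanishesToOrder lam k) (heven : Even k) :
    ∀ᶠ r in 𝓝[>] (0 : ℝ), ∃ θ, IsAngle θ (fun t ↦ Y (z₀ + r • !₂[Real.cos t, Real.sin t])) 0 := by
  obtain ⟨l, hl, hl0, hlam⟩ := exists_eq_pow_mul (h.contDiffAt_lam hY) (k := k)
    (fun j hj ↦ by by_contra hne; exact absurd (hk.2 hne) (not_le.2 hj))
  set Λ := iteratedDeriv k lam 0
  have hΛ : Λ ≠ 0 := hk.1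
  have hpos : 0 < l 0 * Λ := by
    rw [hl0, div_mul_eq_mul_div, ← sq]
    positivity
  have he : Λ • deriv c 0 ≠ 0 := by
    refine smul_ne_zero hΛ fun h0 ↦ h.independent ?_
    rw [h0, cross_zero_left]
  obtain ⟨ρ, a, hρ, ha⟩ := exists_polar he
  -- A constant field has a constant angle, hence degree zero.
  refine eventually_isAngle (G := fun _ ↦ Λ • deriv c 0) ?_ (fun r _ ↦ ⟨fun _ ↦ a,
    continuous_const, fun _ ↦ ⟨ρ, hρ, ha⟩, by simp⟩) ?_
  · filter_upwards [(hY.of_le (m := 1) (by simp)).eventually (by simp)] with z hz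
    exact hz.continuousAt
  · exact h.eventually_punctured hc (h.eventually_add_const_ne_zero heven hl hlam hpos)

end AdaptedCurve

/-! ### Pull-backs to Euclidean space -/

section Pullback

attribute [local instance] chartedSpaceSelf

variable {m n : ℕ} {N : Type*} [TopologicalSpace N] [ChartedSpace (EuclideanSpace ℝ (Fin n)) N]
  [IsManifold (𝓡 n) ∞ N]

local notation "𝔼" d => EuclideanSpace ℝ (Fin d)

/-- The derivative in the fixed direction `u` is the tangent map of `b` after the constant section
`z ↦ (z, u)`. -/
theorem contMDiffAt_mfderiv_apply {b : (𝔼 m) → N} {U : Set (𝔼 m)} (hU : IsOpen U)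
    (hb : ContMDiffOn (𝓡 m) (𝓡 n) ∞ b U) {z : 𝔼 m} (hz : z ∈ U) (u : 𝔼 m) :
    ContMDiffAt (𝓡 m) (𝓡 n).tangent ∞
      (fun z ↦ (⟨b z, mfderiv (𝓡 m) (𝓡 n) b z u⟩ : TangentBundle (𝓡 n) N)) z := by
  have hT := hb.contMDiffOn_tangentMapWithin (m := ∞) (by simp) hU.uniqueMDiffOn
  have hs : ContMDiff (𝓡 m) (𝓡 m).tangent ∞
      (fun z : 𝔼 m ↦ (⟨z, u⟩ : TangentBundle (𝓡 m) (𝔼 m))) := by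
    exact fun z ↦ contMDiffAt_vectorSpace_iff_contDiffAt.2 contDiffAt_const
  have h1 := hT.comp (t := Bundle.TotalSpace.proj ⁻¹' U) hs.contMDiffOn (s := U) (fun z hz ↦ hz)
  refine (h1.contMDiffAt (hU.mem_nhds hz)).congr_of_eventuallyEq ?_
  filter_upwards [hU.mem_nhds hz] with z hz
  simp only [Function.comp, tangentMapWithin]
  rw [mfderivWithin_of_isOpen hU hz]

/-- The pull-back of a one-form by a map from a Euclidean space. -/
def pullbackForm (α : ∀ p : N, TangentSpace (𝓡 n) p →L[ℝ] ℝ) (b : (𝔼 m) → N) (z : 𝔼 m) :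
    (𝔼 m) →L[ℝ] ℝ :=
  (α (b z)).comp (mfderiv (𝓡 m) (𝓡 n) b z)

theorem contDiffOn_pullback_form {α : ∀ p : N, TangentSpace (𝓡 n) p →L[ℝ] ℝ}
    (hα : ContMDiff (𝓡 n) ((𝓡 n).prod 𝓘(ℝ, (𝔼 n) →L[ℝ] ℝ)) ∞
      (fun p ↦ Bundle.TotalSpace.mk' ((𝔼 n) →L[ℝ] ℝ) p (α p)))
    {b : (𝔼 m) → N} {U : Set (𝔼 m)} (hU : IsOpen U)
    (hb : ContMDiffOn (𝓡 m) (𝓡 n) ∞ b U) :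
    ContDiffOn ℝ ∞ (pullbackForm α b) U := by
  rw [contDiffOn_clm_apply]
  intro u z hz
  have h1 : ContMDiffAt (𝓡 m) ((𝓡 n).prod 𝓘(ℝ)) ∞ (fun z ↦ Bundle.TotalSpace.mk' ℝ
      (E := Bundle.Trivial N ℝ) (b z) (α (b z) (mfderiv (𝓡 m) (𝓡 n) b z u))) z := by
    apply ContMDiffAt.clm_bundle_apply (F₁ := 𝔼 n) (F₂ := ℝ)
    · exact hα.contMDiffAt.comp z (hb.contMDiffAt (hU.mem_nhds hz))
    · exact contMDiffAt_mfderiv_apply hU hb hz u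
  rw [Bundle.contMDiffAt_totalSpace] at h1
  exact h1.2.contDiffAt.contDiffWithinAt

/-- The pull-back of a field of bilinear forms by a map from a Euclidean space. -/
def pullbackBilinear (B : ∀ p : N, TangentSpace (𝓡 n) p →L[ℝ] TangentSpace (𝓡 n) p →L[ℝ] ℝ)
    (b : (𝔼 m) → N) (z : 𝔼 m) : (𝔼 m) →L[ℝ] (𝔼 m) →L[ℝ] ℝ :=
  ContinuousLinearMap.bilinearComp (E := 𝔼 n) (F := 𝔼 n) (E' := 𝔼 m) (F' := 𝔼 m)
    (B (b z)) (mfderiv (𝓡 m) (𝓡 n) b z) (mfderiv (𝓡 m) (𝓡 n) b z)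

theorem contDiffOn_pullback_bilinear
    {B : ∀ p : N, TangentSpace (𝓡 n) p →L[ℝ] TangentSpace (𝓡 n) p →L[ℝ] ℝ}
    (hB : ContMDiff (𝓡 n) ((𝓡 n).prod 𝓘(ℝ, (𝔼 n) →L[ℝ] (𝔼 n) →L[ℝ] ℝ)) ∞
      (fun p ↦ Bundle.TotalSpace.mk' ((𝔼 n) →L[ℝ] (𝔼 n) →L[ℝ] ℝ) p (B p)))
    {b : (𝔼 m) → N} {U : Set (𝔼 m)} (hU : IsOpen U)
    (hb : ContMDiffOn (𝓡 m) (𝓡 n) ∞ b U) :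
    ContDiffOn ℝ ∞ (pullbackBilinear B b) U := by
  rw [contDiffOn_clm_apply]
  intro u
  rw [contDiffOn_clm_apply]
  intro v z hz
  have h1 : ContMDiffAt (𝓡 m) ((𝓡 n).prod 𝓘(ℝ)) ∞ (fun z ↦ Bundle.TotalSpace.mk' ℝ
      (E := Bundle.Trivial N ℝ) (b z)
      (B (b z) (mfderiv (𝓡 m) (𝓡 n) b z u) (mfderiv (𝓡 m) (𝓡 n) b z v))) z := by
    apply ContMDiffAt.clm_bundle_apply₂ (F₁ := 𝔼 n) (F₂ := 𝔼 n) (F₃ := ℝ)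
    · exact hB.contMDiffAt.comp z (hb.contMDiffAt (hU.mem_nhds hz))
    · exact contMDiffAt_mfderiv_apply hU hb hz u
    · exact contMDiffAt_mfderiv_apply hU hb hz v
  rw [Bundle.contMDiffAt_totalSpace] at h1
  exact h1.2.contDiffAt.contDiffWithinAt

end Pullback

/-- In suitable charts an immersion is the inclusion of a factor, so the projection onto that factor
gives a local left inverse `g`, and the chain rule makes its differential a left inverse of that of
`i`. -/
theorem mfderiv_injective_of_isSmoothEmbedding {m n : ℕ} {N N' : Type*}
    [TopologicalSpace N] [ChartedSpace (EuclideanSpace ℝ (Fin m)) N] [IsManifold (𝓡 m) ∞ N]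
    [TopologicalSpace N'] [ChartedSpace (EuclideanSpace ℝ (Fin n)) N'] [IsManifold (𝓡 n) ∞ N']
    {i : N → N'} (hi : IsSmoothEmbedding (𝓡 m) (𝓡 n) ∞ i) (p : N) :
    Function.Injective (mfderiv (𝓡 m) (𝓡 n) i p) := by
  have h := hi.isImmersion.isImmersionAt p
  set g : N' → N := fun y ↦ h.domChart.symm (h.equiv.symm (h.codChart y)).1 with hg
  have hw := h.writtenInCharts
  have hgi : g ∘ i =ᶠ[𝓝 p] id := by
    filter_upwards [h.domChart.open_source.mem_nhds h.mem_domChart_source] with x hx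
    have h1 : h.domChart x ∈ (h.domChart.extend (𝓡 m)).target := by
      simpa using h.domChart.map_source hx
    have h2 := hw h1
    simp only [Function.comp, OpenPartialHomeomorph.extend_coe, OpenPartialHomeomorph.extend_coe_symm,
      modelWithCornersSelf_coe, modelWithCornersSelf_coe_symm, id, h.domChart.left_inv hx] at h2
    simp only [hg, Function.comp, h2]
    simp [h.domChart.left_inv hx]
  have hgd : MDifferentiableAt (𝓡 n) (𝓡 m) g (i p) := by
    have h1 : MDifferentiableAt (𝓡 n) (𝓡 n) h.codChart (i p) :=
      (contMDiffAt_of_mem_maximalAtlas h.codChart_mem_maximalAtlas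
        h.mem_codChart_source).mdifferentiableAt (by simp)
    have h2 : (h.equiv.symm (h.codChart (i p))).1 ∈ h.domChart.target := by
      have h1 : h.domChart p ∈ (h.domChart.extend (𝓡 m)).target := by
        simpa using h.domChart.map_source h.mem_domChart_source
      have h2 := hw h1
      simp only [Function.comp, OpenPartialHomeomorph.extend_coe,
        OpenPartialHomeomorph.extend_coe_symm, modelWithCornersSelf_coe,
        modelWithCornersSelf_coe_symm, id, h.domChart.left_inv h.mem_domChart_source] at h2
      rw [h2]
      simpa using h.domChart.map_source h.mem_domChart_source
    have h3 : MDifferentiableAt (𝓡 m) (𝓡 m) h.domChart.symm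
        (h.equiv.symm (h.codChart (i p))).1 :=
      (contMDiffAt_symm_of_mem_maximalAtlas h.domChart_mem_maximalAtlas h2).mdifferentiableAt
        (by simp)
    have h4 : MDifferentiableAt (𝓡 n) (𝓡 m) (fun y ↦ (h.equiv.symm y).1) (h.codChart (i p)) := by
      refine DifferentiableAt.mdifferentiableAt ?_
      exact DifferentiableAt.fst (h.equiv.symm.differentiableAt)
    exact h3.comp (i p) (h4.comp (i p) h1)
  have hid : MDifferentiableAt (𝓡 m) (𝓡 n) i p := hi.contMDiff.mdifferentiableAt (by simp)
  have hcomp : (mfderiv (𝓡 n) (𝓡 m) g (i p)).comp (mfderiv (𝓡 m) (𝓡 n) i p) =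
      (ContinuousLinearMap.id ℝ (EuclideanSpace ℝ (Fin m)) : _) := by
    rw [← mfderiv_comp p hgd hid, hgi.mfderiv_eq]
    exact mfderiv_id
  intro u v huv
  have h1 := congrArg (mfderiv (𝓡 n) (𝓡 m) g (i p)) huv
  have h2 (w : TangentSpace (𝓡 m) p) :
      (mfderiv (𝓡 n) (𝓡 m) g (i p)) ((mfderiv (𝓡 m) (𝓡 n) i p) w) = w :=
    congrArg (fun L : (EuclideanSpace ℝ (Fin m)) →L[ℝ] (EuclideanSpace ℝ (Fin m)) ↦ L w) hcomp
  exact (h2 u).symm.trans (h1.trans (h2 v))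

/-! ### Tensor fields in the preferred chart -/

section ChartCoordinates

set_option linter.unusedSectionVars false

attribute [local instance] chartedSpaceSelf

variable {n : ℕ} {N : Type*} [TopologicalSpace N] [ChartedSpace (EuclideanSpace ℝ (Fin n)) N]
  [IsManifold (𝓡 n) ∞ N]

local notation "𝔼" d => EuclideanSpace ℝ (Fin d)

/-- The inverse of the preferred chart at `q`. -/
def chartInv (q : N) : (𝔼 n) → N := (extChartAt (𝓡 n) q).symm

theorem contMDiffOn_chartInv (q : N) :
    ContMDiffOn (𝓡 n) (𝓡 n) ∞ (chartInv q) (extChartAt (𝓡 n) q).target :=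
  contMDiffOn_extChartAt_symm q

theorem mfderivWithin_range_eq (q : N) (z : 𝔼 n) :
    mfderivWithin (𝓡 n) (𝓡 n) (extChartAt (𝓡 n) q).symm (range (𝓡 n)) z =
      mfderiv (𝓡 n) (𝓡 n) (chartInv q) z := by
  rw [ModelWithCorners.range_eq_univ, mfderivWithin_univ]
  rfl

theorem oneFormInChart_eq (α : ∀ p : N, TangentSpace (𝓡 n) p →L[ℝ] ℝ) (q : N) :
    oneFormInChart α q = pullbackForm α (chartInv q) := by
  funext z
  exact congrArg (fun L : (𝔼 n) →L[ℝ] (𝔼 n) ↦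
    ContinuousLinearMap.comp (α (chartInv q z) : (𝔼 n) →L[ℝ] ℝ) L) (mfderivWithin_range_eq q z)

theorem mfderiv_fieldInChart (X : ∀ p : N, TangentSpace (𝓡 n) p) (q : N) {z : 𝔼 n}
    (hz : z ∈ (extChartAt (𝓡 n) q).target) :
    mfderiv (𝓡 n) (𝓡 n) (chartInv q) z (fieldInChart X q z) = X (chartInv q z) := by
  have hM : IsManifold (𝓡 n) 1 N := IsManifold.of_le (n := ∞) (by simp)
  have h1 := isInvertible_mfderivWithin_extChartAt_symm (I := 𝓡 n) hz
  rw [← mfderivWithin_range_eq]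
  exact h1.self_apply_inverse _

theorem chartInv_self (q : N) : chartInv q (extChartAt (𝓡 n) q q) = q := extChartAt_to_inv q

/-- The tangent space at `q` is `ℝⁿ` through the preferred chart, so the inverse chart has identity
differential at the base point. The dependent function `F` carries the equality of base points, on
which the types of tangent vectors depend. -/
theorem apply_mfderiv_chartInv {β : Type*} (F : ∀ p : N, TangentSpace (𝓡 n) p → β) (q : N)
    (u : 𝔼 n) :
    F (chartInv q (extChartAt (𝓡 n) q q))
      (mfderiv (𝓡 n) (𝓡 n) (chartInv q) (extChartAt (𝓡 n) q q) u) = F q u := by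
  have hM : IsManifold (𝓡 n) 1 N := IsManifold.of_le (n := ∞) (by simp)
  have h1 : mfderiv (𝓡 n) (𝓡 n) (chartInv q) (extChartAt (𝓡 n) q q) =
      ContinuousLinearMap.id ℝ (𝔼 n) := by
    rw [← mfderivWithin_range_eq]
    exact mfderivWithin_range_extChartAt_symm
  have h2 : ∀ q', chartInv q (extChartAt (𝓡 n) q q) = q' →
      F (chartInv q (extChartAt (𝓡 n) q q)) u = F q' u := by
    rintro _ rfl; rfl
  rw [← h2 q (chartInv_self q)]
  exact congrArg (fun L : (𝔼 n) →L[ℝ] (𝔼 n) ↦ F (chartInv q (extChartAt (𝓡 n) q q)) (L u)) h1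

theorem apply_mfderiv_chartInv₂ {β : Type*}
    (F : ∀ p : N, TangentSpace (𝓡 n) p → TangentSpace (𝓡 n) p → β) (q : N) (u v : 𝔼 n) :
    F (chartInv q (extChartAt (𝓡 n) q q))
      (mfderiv (𝓡 n) (𝓡 n) (chartInv q) (extChartAt (𝓡 n) q q) u)
      (mfderiv (𝓡 n) (𝓡 n) (chartInv q) (extChartAt (𝓡 n) q q) v) = F q u v := by
  have h1 := apply_mfderiv_chartInv (β := 𝔼 n) (fun p (w : TangentSpace (𝓡 n) p) ↦ (w : 𝔼 n)) q v
  refine Eq.trans ?_ (apply_mfderiv_chartInv (fun p w ↦ F p w (v : 𝔼 n)) q u)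
  exact congrArg (fun w : 𝔼 n ↦ F (chartInv q (extChartAt (𝓡 n) q q))
    (mfderiv (𝓡 n) (𝓡 n) (chartInv q) (extChartAt (𝓡 n) q q) u) w) h1

theorem contDiffAt_fieldInChart {X : ∀ p : N, TangentSpace (𝓡 n) p}
    (hX : ContMDiff (𝓡 n) (𝓡 n).tangent ∞ (fun p ↦ (⟨p, X p⟩ : TangentBundle (𝓡 n) N))) (q : N) :
    ContDiffAt ℝ ∞ (fieldInChart X q) (extChartAt (𝓡 n) q q) := by
  have h1 := VectorField.contMDiffWithinAt_mpullbackWithin_extChartAt_symm (I := 𝓡 n) (m := ∞)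
    (n := ∞) (s := univ) (x := q) (V := X) hX.contMDiffAt.contMDiffWithinAt uniqueMDiffOn_univ
    (mem_univ _) (by simp)
  have h2 : (extChartAt (𝓡 n) q).target ∩ (extChartAt (𝓡 n) q).symm ⁻¹' univ ∈
      𝓝 (extChartAt (𝓡 n) q q) := by
    rw [preimage_univ, inter_univ]
    exact extChartAt_target_mem_nhds q
  exact contMDiffAt_vectorSpace_iff_contDiffAt.1 (h1.contMDiffAt h2)

theorem oneForm_contDiffAt {α : ∀ p : N, TangentSpace (𝓡 n) p →L[ℝ] ℝ}
    (hα : ContMDiff (𝓡 n) ((𝓡 n).prod 𝓘(ℝ, (𝔼 n) →L[ℝ] ℝ)) ∞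
      (fun p ↦ Bundle.TotalSpace.mk' ((𝔼 n) →L[ℝ] ℝ) p (α p))) (q : N) :
    ContDiffAt ℝ ∞ (oneFormInChart α q) (extChartAt (𝓡 n) q q) := by
  rw [oneFormInChart_eq]
  exact (contDiffOn_pullback_form hα (isOpen_extChartAt_target q)
    (contMDiffOn_chartInv q)).contDiffAt (extChartAt_target_mem_nhds q)

variable {m : ℕ} {N' : Type*} [TopologicalSpace N'] [ChartedSpace (EuclideanSpace ℝ (Fin m)) N']
  [IsManifold (𝓡 m) ∞ N']

theorem apply_mfderiv_congr {E : Type*} [NormedAddCommGroup E] [NormedSpace ℝ E] {β : Type*}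
    (F : ∀ p : N, TangentSpace (𝓡 n) p → β) {f g : E → N}
    {z : E} (hfg : f =ᶠ[𝓝 z] g) (v : E) :
    F (f z) (mfderiv 𝓘(ℝ, E) (𝓡 n) f z v) = F (g z) (mfderiv 𝓘(ℝ, E) (𝓡 n) g z v) := by
  have h1 : (mfderiv 𝓘(ℝ, E) (𝓡 n) f z : E →L[ℝ] (𝔼 n)) = mfderiv 𝓘(ℝ, E) (𝓡 n) g z :=
    hfg.mfderiv_eq
  have h2 : ∀ p, f z = p → ∀ w : 𝔼 n, F (f z) w = F p w := by
    rintro _ rfl w; rfl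
  exact (congrArg (fun L : E →L[ℝ] (𝔼 n) ↦ F (f z) (L v)) h1).trans
    (h2 (g z) hfg.self_of_nhds _)

/-- The exterior derivative commutes with pull-backs. -/
theorem dOneForm_pullback {i : N' → N} (hi : ContMDiff (𝓡 m) (𝓡 n) ∞ i)
    {α : ∀ p : N, TangentSpace (𝓡 n) p →L[ℝ] ℝ}
    (hα : ContMDiff (𝓡 n) ((𝓡 n).prod 𝓘(ℝ, (𝔼 n) →L[ℝ] ℝ)) ∞
      (fun p ↦ Bundle.TotalSpace.mk' ((𝔼 n) →L[ℝ] ℝ) p (α p))) (q : N')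
    (u v : TangentSpace (𝓡 m) q) :
    dOneForm (fun p ↦ (α (i p)).comp (mfderiv (𝓡 m) (𝓡 n) i p)) q u v =
      dOneForm α (i q) (mfderiv (𝓡 m) (𝓡 n) i q u) (mfderiv (𝓡 m) (𝓡 n) i q v) := by
  set z₀ := extChartAt (𝓡 m) q q with hz₀
  set j : (𝔼 m) → (𝔼 n) := fun z ↦ extChartAt (𝓡 n) (i q) (i (chartInv q z)) with hj
  set W : (𝔼 n) → (𝔼 n) →L[ℝ] ℝ := oneFormInChart α (i q) with hW
  have hjz : j z₀ = extChartAt (𝓡 n) (i q) (i q) := by simp only [hj, hz₀, chartInv_self]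
  have hjs : ContDiffAt ℝ ∞ j z₀ := by
    have h1 : ContMDiffAt (𝓡 m) (𝓡 m) ∞ (chartInv q) z₀ :=
      (contMDiffOn_chartInv q).contMDiffAt (extChartAt_target_mem_nhds q)
    have h2 : ContMDiffAt (𝓡 m) (𝓡 n) ∞ (fun z ↦ i (chartInv q z)) z₀ :=
      hi.contMDiffAt.comp z₀ h1
    have h3 : ContMDiffAt (𝓡 n) (𝓡 n) ∞ (extChartAt (𝓡 n) (i q)) (i (chartInv q z₀)) := by
      rw [chartInv_self]; exact contMDiffAt_extChartAt
    exact (h3.comp z₀ h2).contDiffAt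
  have hmj : (mfderiv (𝓡 m) (𝓡 n) i q : (𝔼 m) →L[ℝ] (𝔼 n)) = fderiv ℝ j z₀ := by
    have hd : MDifferentiableAt (𝓡 m) (𝓡 n) i q := hi.mdifferentiableAt (by simp)
    refine hd.mfderiv.trans ?_
    rw [ModelWithCorners.range_eq_univ, fderivWithin_univ]
    rfl
  have hWd : DifferentiableAt ℝ W (j z₀) := by
    rw [hjz]; exact (oneForm_contDiffAt hα (i q)).differentiableAt (by simp)
  -- In coordinates the pulled-back form is the pull-back of `W` by the coordinate expression `j` of
  -- `i`; what remains is calculus in Euclidean space.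
  have hev : oneFormInChart (fun p ↦ (α (i p)).comp (mfderiv (𝓡 m) (𝓡 n) i p)) q =ᶠ[𝓝 z₀]
      fun z ↦ (W (j z)).comp (fderiv ℝ j z) := by
    have h1 : Tendsto (fun z ↦ i (chartInv q z)) (𝓝 z₀) (𝓝 (i q)) := by
      have h2 : ContinuousAt (chartInv q) z₀ := continuousAt_extChartAt_symm q
      have h3 := (hi.continuous.continuousAt (x := chartInv q z₀)).comp h2
      have h4 : (i ∘ chartInv q) z₀ = i q := by simp only [Function.comp, hz₀, chartInv_self]
      rw [← h4]
      exact h3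
    filter_upwards [(h1.eventually (extChartAt_source_mem_nhds (I := 𝓡 n) (i q))).eventually_nhds,
      extChartAt_target_mem_nhds (I := 𝓡 m) q, (hjs.of_le (m := 1) (by simp)).eventually (by simp)]
      with z hz hzt hjz'
    ext v
    rw [oneFormInChart_eq, hW, oneFormInChart_eq]
    have hb : MDifferentiableAt (𝓡 m) (𝓡 m) (chartInv q) z :=
      ((contMDiffOn_chartInv q).contMDiffAt ((isOpen_extChartAt_target q).mem_nhds hzt)
        ).mdifferentiableAt (by simp)
    have hjt : j z ∈ (extChartAt (𝓡 n) (i q)).target :=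
      (extChartAt (𝓡 n) (i q)).map_source hz.self_of_nhds
    have hb' : MDifferentiableAt (𝓡 n) (𝓡 n) (chartInv (i q)) (j z) :=
      ((contMDiffOn_chartInv (i q)).contMDiffAt ((isOpen_extChartAt_target _).mem_nhds hjt)
        ).mdifferentiableAt (by simp)
    have hj' : MDifferentiableAt (𝓡 m) (𝓡 n) j z :=
      (hjz'.differentiableAt (by simp)).mdifferentiableAt
    have hi' : MDifferentiableAt (𝓡 m) (𝓡 n) i (chartInv q z) := hi.mdifferentiableAt (by simp)
    have hfg : (chartInv (i q) ∘ j) =ᶠ[𝓝 z] i ∘ chartInv q := by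
      filter_upwards [hz] with y hy
      exact (extChartAt (𝓡 n) (i q)).left_inv hy
    have h5 := apply_mfderiv_congr (fun p w ↦ α p w) hfg v
    have e1 : mfderiv (𝓡 m) (𝓡 n) (chartInv (i q) ∘ j) z = (mfderiv (𝓡 n) (𝓡 n) (chartInv (i q))
        (j z)).comp (mfderiv (𝓡 m) (𝓡 n) j z) := mfderiv_comp z hb' hj'
    have e2 : mfderiv (𝓡 m) (𝓡 n) (i ∘ chartInv q) z = (mfderiv (𝓡 m) (𝓡 n) i
        (chartInv q z)).comp (mfderiv (𝓡 m) (𝓡 m) (chartInv q) z) := mfderiv_comp z hi' hb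
    rw [e1, e2, mfderiv_eq_fderiv] at h5
    exact h5.symm
  have hD : DifferentiableAt ℝ (fderiv ℝ j) z₀ :=
    (hjs.fderiv_right (m := ∞) (by simp)).differentiableAt (by simp)
  have hjd : DifferentiableAt ℝ j z₀ := hjs.differentiableAt (by simp)
  have hder (u v : 𝔼 m) :
      derivOneForm (fun p ↦ (α (i p)).comp (mfderiv (𝓡 m) (𝓡 n) i p)) q u v =
      fderiv ℝ W (j z₀) (fderiv ℝ j z₀ u) (fderiv ℝ j z₀ v) +
        W (j z₀) (fderiv ℝ (fderiv ℝ j) z₀ u v) := by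
    have h1 : HasFDerivAt (fun z ↦ W (j z)) ((fderiv ℝ W (j z₀)).comp (fderiv ℝ j z₀)) z₀ :=
      hWd.hasFDerivAt.comp z₀ hjd.hasFDerivAt
    have h2 := h1.clm_comp hD.hasFDerivAt
    refine (congrArg (fun L : (𝔼 m) →L[ℝ] (𝔼 m) →L[ℝ] ℝ ↦ L u v)
      (hev.fderiv_eq.trans h2.fderiv)).trans ?_
    simp
    abel
  -- The term with second derivatives of `j` is symmetric and cancels in the antisymmetrization.
  have hsymm : fderiv ℝ (fderiv ℝ j) z₀ u v = fderiv ℝ (fderiv ℝ j) z₀ v u :=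
    (hjs.isSymmSndFDerivAt (by
      rw [minSmoothness_of_isRCLikeNormedField]; exact ENat.LEInfty.out)) u v
  have hd (u v : 𝔼 m) : derivOneForm α (i q) (mfderiv (𝓡 m) (𝓡 n) i q u)
      (mfderiv (𝓡 m) (𝓡 n) i q v) = fderiv ℝ W (j z₀) (fderiv ℝ j z₀ u) (fderiv ℝ j z₀ v) := by
    rw [derivOneForm, hjz]
    exact congrArg (fun L : (𝔼 m) →L[ℝ] (𝔼 n) ↦ fderiv ℝ W (extChartAt (𝓡 n) (i q) (i q))
      (L u) (L v)) hmj
  unfold dOneForm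
  refine (congrArg₂ _ (hder u v) (hder v u)).trans (Eq.trans ?_ (congrArg₂ _ (hd u v) (hd v u)).symm)
  rw [hsymm]
  ring

end ChartCoordinates

/-! ### The area form and the characteristic field -/

theorem exists_eq_smul_of_cross_eq_zero {u w : Plane} (h : cross u w = 0) (hw : w ≠ 0) :
    ∃ a : ℝ, u = a • w := by
  unfold cross at h
  by_cases h0 : w 0 = 0
  · have h1 : w 1 ≠ 0 := by
      intro h1
      apply hw
      ext j; fin_cases j <;> simp [h0, h1]
    refine ⟨u 1 / w 1, ?_⟩
    rw [h0, mul_zero, sub_zero] at h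
    have h2 := (mul_eq_zero.1 h).resolve_right h1
    ext j; fin_cases j <;> simp [h0, h1, h2]
  · refine ⟨u 0 / w 0, ?_⟩
    ext j; fin_cases j
    · simp [h0]
    · simp; field_simp; linarith

theorem eq_zero_of_cross {u : Plane} (h : ∀ v, cross u v = 0) : u = 0 := by
  have h0 := h !₂[0, 1]
  have h1 := h !₂[1, 0]
  simp [cross] at h0 h1
  ext j; fin_cases j <;> simp [h0, h1]

theorem alternating_eq_cross (B : Plane →L[ℝ] Plane →L[ℝ] ℝ) (hB : ∀ u, B u u = 0) (u v : Plane) :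
    B u v = cross u v * B !₂[1, 0] !₂[0, 1] := by
  have hdec (v : Plane) : v = v 0 • !₂[1, 0] + v 1 • !₂[0, 1] := by
    ext j; fin_cases j <;> simp
  have hsw : B !₂[0, 1] !₂[1, 0] = -B !₂[1, 0] !₂[0, 1] := by
    have := hB (!₂[1, 0] + !₂[0, 1])
    simp only [map_add, add_apply, hB] at this
    linarith
  conv_lhs => rw [hdec u, hdec v]
  simp only [map_add, map_smul, add_apply, smul_apply, smul_eq_mul, hB, hsw, cross]
  ring

section Surface

attribute [local instance] chartedSpaceSelf

variable {M : Type*} [TopologicalSpace M] [ChartedSpace (EuclideanSpace ℝ (Fin 3)) M]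
  [IsManifold (𝓡 3) ∞ M] {S : Type*} [TopologicalSpace S]
  [ChartedSpace (EuclideanSpace ℝ (Fin 2)) S] [IsManifold (𝓡 2) ∞ S]

theorem ContactSubRiemannian.g₁_pos (C : ContactSubRiemannian M) (p : M) {u : TangentSpace (𝓡 3) p}
    (hu : u ≠ 0) : 0 < C.g₁ p u u := by
  unfold ContactSubRiemannian.g₁
  have hr := (C.isReebAt_reeb p).1
  set h := u - C.form p u • C.reeb p with hh
  have hω : C.form p h = 0 := by simp [hh, hr]
  rcases eq_or_ne h 0 with h0 | h0
  · rw [h0]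
    have : C.form p u ≠ 0 := by
      intro h1
      rw [h1, zero_smul, sub_zero] at hh
      exact hu (hh.symm.trans h0)
    simp only [map_zero, zero_add]
    exact mul_self_pos.2 this
  · have := C.g_pos p h hω h0
    nlinarith [mul_self_nonneg (C.form p u)]

theorem ContactSubRiemannian.g₁_smul_left (C : ContactSubRiemannian M) (p : M) (a : ℝ)
    (u v : TangentSpace (𝓡 3) p) : C.g₁ p (a • u) v = a * C.g₁ p u v := by
  unfold ContactSubRiemannian.g₁
  have : a • u - C.form p (a • u) • C.reeb p = a • (u - C.form p u • C.reeb p) := by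
    rw [map_smul, smul_sub, smul_assoc]
  rw [this, map_smul, map_smul]
  simp only [smul_apply, smul_eq_mul]
  ring

theorem ContactSubRiemannian.g₁_smul_right (C : ContactSubRiemannian M) (p : M) (a : ℝ)
    (u v : TangentSpace (𝓡 3) p) : C.g₁ p u (a • v) = a * C.g₁ p u v := by
  unfold ContactSubRiemannian.g₁
  have : a • v - C.form p (a • v) • C.reeb p = a • (v - C.form p v • C.reeb p) := by
    rw [map_smul, smul_sub, smul_assoc]
  rw [this, map_smul, map_smul]
  simp only [smul_eq_mul]
  ring

theorem ContactSubRiemannian.g₁_sub_right (C : ContactSubRiemannian M) (p : M)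
    (u v w : TangentSpace (𝓡 3) p) : C.g₁ p u (v - w) = C.g₁ p u v - C.g₁ p u w := by
  unfold ContactSubRiemannian.g₁
  have : (v - w) - C.form p (v - w) • C.reeb p =
      (v - C.form p v • C.reeb p) - (w - C.form p w • C.reeb p) := by
    rw [map_sub, sub_smul]; abel
  rw [this, (C.g p _).map_sub, (C.form p).map_sub]
  ring

variable {C : ContactSubRiemannian M} {i : S → M} {o : SurfaceOrientation S}
    {σ : ∀ p : S, TangentSpace (𝓡 2) p →L[ℝ] TangentSpace (𝓡 2) p →L[ℝ] ℝ}
    {X : ∀ p : S, TangentSpace (𝓡 2) p}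

/-- Gram–Schmidt for `g¹` produces an orthonormal frame of `T_p S`, and the sign of its second
vector can be chosen to make it positively oriented; on such a frame `σ` equals one. -/
theorem IsAreaForm.ne_zero (hσ : IsAreaForm C i o σ) (hi : IsSmoothEmbedding (𝓡 2) (𝓡 3) ∞ i)
    (p : S) : σ p ≠ 0 := by
  intro hzero
  have hinj := mfderiv_injective_of_isSmoothEmbedding hi p
  set L := mfderiv (𝓡 2) (𝓡 3) i p
  set b : TangentSpace (𝓡 2) p → TangentSpace (𝓡 2) p → ℝ := fun u v ↦ C.g₁ (i p) (L u) (L v)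
  have hpos (u : TangentSpace (𝓡 2) p) (hu : u ≠ 0) : 0 < b u u :=
    C.g₁_pos _ fun h ↦ hu (hinj (h.trans (map_zero L).symm))
  have hsl (a : ℝ) (u v : TangentSpace (𝓡 2) p) : b (a • u) v = a * b u v := by
    simp only [b, map_smul, C.g₁_smul_left]
  have hsr (a : ℝ) (u v : TangentSpace (𝓡 2) p) : b u (a • v) = a * b u v := by
    simp only [b, map_smul, C.g₁_smul_right]
  have hsub (u v w : TangentSpace (𝓡 2) p) : b u (v - w) = b u v - b u w := by
    simp only [b, map_sub, C.g₁_sub_right]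
  obtain ⟨e, e', hee⟩ : ∃ e e' : TangentSpace (𝓡 2) p, o.τ p e e' ≠ 0 := by
    by_contra! h
    exact o.ne_zero p (ContinuousLinearMap.ext fun u ↦ ContinuousLinearMap.ext fun v ↦ h u v)
  have hτ := o.isTwoForm.alternating p
  have he : e ≠ 0 := by rintro rfl; simp at hee
  set s := (√(b e e))⁻¹ with hs
  have hs0 : 0 < s := inv_pos.2 (Real.sqrt_pos.2 (hpos e he))
  have hss : s * (s * b e e) = 1 := by
    have h1 := Real.mul_self_sqrt (hpos e he).le
    have h2 := (Real.sqrt_pos.2 (hpos e he)).ne'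
    rw [hs]
    field_simp
    nlinarith
  set v₁ := s • e
  have hv₁ : b v₁ v₁ = 1 := by rw [hsl, hsr, hss]
  set w := e' - b v₁ e' • v₁
  have hw : o.τ p v₁ w ≠ 0 := by
    simp only [w, v₁, map_sub, map_smul, smul_apply, hτ, smul_eq_mul, mul_zero, sub_zero]
    exact mul_ne_zero hs0.ne' hee
  have hw0 : w ≠ 0 := by intro h; rw [h] at hw; simp at hw
  have hv₁w : b v₁ w = 0 := by simp only [w]; rw [hsub, hsr, hv₁]; ring
  have key (a : ℝ) (ha : a * (a * b w w) = 1) (hpos : 0 < a * o.τ p v₁ w) : False := by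
    have h1 := hσ.eq_one p v₁ (a • w) (by simpa using hpos) hv₁
      ((hsl _ _ _).trans (by rw [hsr, ha])) ((hsr _ _ _).trans (by rw [hv₁w, mul_zero]))
    rw [hzero] at h1
    simp at h1
  set r := (√(b w w))⁻¹ with hr
  have hr0 : 0 < r := inv_pos.2 (Real.sqrt_pos.2 (hpos w hw0))
  have hrr : r * (r * b w w) = 1 := by
    have h1 := Real.mul_self_sqrt (hpos w hw0).le
    have h2 := (Real.sqrt_pos.2 (hpos w hw0)).ne'
    rw [hr]
    field_simp
    nlinarith
  rcases hw.lt_or_gt with h | h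
  · exact key (-r) (by linarith) (by nlinarith)
  · exact key r hrr (by positivity)

theorem IsAreaForm.eq_cross (hσ : IsAreaForm C i o σ) (p : S) (u v : Plane) :
    σ p u v = cross u v * σ p (!₂[1, 0] : Plane) (!₂[0, 1] : Plane) :=
  alternating_eq_cross (σ p) (hσ.isTwoForm.alternating p) u v

theorem IsAreaForm.frame_ne_zero (hσ : IsAreaForm C i o σ)
    (hi : IsSmoothEmbedding (𝓡 2) (𝓡 3) ∞ i) (p : S) :
    σ p (!₂[1, 0] : Plane) (!₂[0, 1] : Plane) ≠ 0 := by
  intro h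
  apply hσ.ne_zero hi p
  refine ContinuousLinearMap.ext fun u ↦ ContinuousLinearMap.ext fun v ↦ ?_
  exact (hσ.eq_cross p u v).trans (by rw [h, mul_zero]; rfl)

/-- At a characteristic point `ω` vanishes on `T_p S`, so `ι_X σ = 0` there, and a non-zero area
form in dimension two is non-degenerate. -/
theorem IsCharacteristicField.eq_zero (hX : IsCharacteristicField C i σ X)
    (hσ : IsAreaForm C i o σ) (hi : IsSmoothEmbedding (𝓡 2) (𝓡 3) ∞ i) {p : S}
    (hp : IsCharacteristic C i p) : X p = 0 := by
  refine eq_zero_of_cross (u := X p) fun v ↦ ?_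
  have h1 : σ p (X p) v = 0 := by
    have h2 : mfderiv (𝓡 2) (𝓡 3) i p v ∈ range (mfderiv (𝓡 2) (𝓡 3) i p) := mem_range_self _
    rw [hp] at h2
    exact (hX.interior_eq p v).trans h2
  have h2 := (hσ.eq_cross p (X p) v).symm.trans h1
  exact (mul_eq_zero.1 h2).resolve_right (hσ.frame_ne_zero hi p)

/-- The exterior derivative of `ι_X σ` at a zero of `X`. -/
theorem dOneForm_interior (hσ : IsTwoForm σ)
    (hX : ContMDiff (𝓡 2) (𝓡 2).tangent ∞ (fun p ↦ (⟨p, X p⟩ : TangentBundle (𝓡 2) S))) {q : S}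
    (hq : X q = 0) (u v : Plane) :
    dOneForm (fun p ↦ σ p (X p)) q u v =
      σ q (differentialAt X q u) v - σ q (differentialAt X q v) u := by
  set z₀ := extChartAt (𝓡 2) q q with hz₀
  set T := pullbackBilinear σ (chartInv (n := 2) q)
  set Y := fieldInChart X q
  have hT : DifferentiableAt ℝ T z₀ :=
    ((contDiffOn_pullback_bilinear hσ.smooth (isOpen_extChartAt_target q)
      (contMDiffOn_chartInv q)).contDiffAt (extChartAt_target_mem_nhds q)).differentiableAt (by simp)
  have hYd : DifferentiableAt ℝ Y z₀ :=
    (contDiffAt_fieldInChart hX q).differentiableAt (by simp)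
  have hY0 : Y z₀ = 0 := by
    have h1 := apply_mfderiv_chartInv (n := 2) (β := Plane)
      (fun (p : S) (w : TangentSpace (𝓡 2) p) ↦ (w : Plane)) q (Y z₀)
    have h2 : (mfderiv (𝓡 2) (𝓡 2) (chartInv q) z₀ (Y z₀) : Plane) = X (chartInv q z₀) :=
      mfderiv_fieldInChart X q (mem_extChartAt_target q)
    have h3 : ∀ q' : S, q' = q → (X q' : Plane) = X q := by rintro _ rfl; rfl
    exact h1.symm.trans (h2.trans ((h3 _ (chartInv_self q)).trans hq))
  have hev : oneFormInChart (fun p ↦ σ p (X p)) q =ᶠ[𝓝 z₀] fun z ↦ T z (Y z) := by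
    filter_upwards [extChartAt_target_mem_nhds (I := 𝓡 2) q] with z hz
    rw [oneFormInChart_eq]
    ext v
    have h1 : (mfderiv (𝓡 2) (𝓡 2) (chartInv q) z (Y z) : Plane) = X (chartInv q z) :=
      mfderiv_fieldInChart X q hz
    exact (congrArg (fun x : Plane ↦ σ (chartInv q z) x
      (mfderiv (𝓡 2) (𝓡 2) (chartInv q) z v)) h1).symm
  -- In the product rule for `T z (Y z)` the term with the derivative of `T` is evaluated at `Y z₀ =
  -- 0`.
  have hder (u v : Plane) : derivOneForm (fun p ↦ σ p (X p)) q u v =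
      σ q (differentialAt X q u) v := by
    have h2 := hT.hasFDerivAt.clm_apply hYd.hasFDerivAt
    refine (congrArg (fun L : Plane →L[ℝ] Plane →L[ℝ] ℝ ↦ L u v)
      (hev.fderiv_eq.trans h2.fderiv)).trans ?_
    rw [hY0]
    simp only [ContinuousLinearMap.comp_apply, map_zero, add_zero]
    exact apply_mfderiv_chartInv₂ (fun p x y ↦ σ p x y) q (fderiv ℝ Y z₀ u) v
  exact congrArg₂ _ (hder u v) (hder v u)

end Surface

/-! ### The characteristic field at a degenerate characteristic point -/

theorem eventually_norm_sub_lt {F G : Type*} [TopologicalSpace F] [SeminormedAddCommGroup G]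
    {Q : F → G} {z₀ : F} (hQ : ContinuousAt Q z₀) {ε : ℝ} (hε : 0 < ε) :
    ∀ᶠ z in 𝓝 z₀, ‖Q z - Q z₀‖ < ε := by
  filter_upwards [Metric.continuousAt_iff'.1 hQ ε hε] with z hz
  rwa [dist_eq_norm] at hz

/-- Compactness of the unit sphere gives `Q z₀ u u ≥ m ‖u‖²`, and a perturbation of norm less than
`m / 2` leaves half of it. Positivity is thus needed at `z₀` only. -/
theorem exists_sqrt_bounds {E F : Type*} [NormedAddCommGroup E] [NormedSpace ℝ E] [ProperSpace E]
    [Nontrivial E] [TopologicalSpace F] {Q : F → E →L[ℝ] E →L[ℝ] ℝ} {z₀ : F}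
    (hQ : ContinuousAt Q z₀) (hpos : ∀ u ≠ 0, 0 < Q z₀ u u) :
    ∃ c > 0, ∀ᶠ z in 𝓝 z₀, ∀ u, c⁻¹ * ‖u‖ ≤ √(Q z u u) ∧ √(Q z u u) ≤ c * ‖u‖ := by
  have hcont : Continuous fun u ↦ Q z₀ u u := by fun_prop
  obtain ⟨u₀, hu₀, hmin⟩ := (isCompact_sphere (0 : E) 1).exists_isMinOn
    (NormedSpace.sphere_nonempty.2 zero_le_one) hcont.continuousOn
  set m := Q z₀ u₀ u₀
  have hm : 0 < m := hpos u₀ (by rintro rfl; simp at hu₀)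
  have hlow (u : E) : m * ‖u‖ ^ 2 ≤ Q z₀ u u := by
    rcases eq_or_ne u 0 with rfl | hu
    · simp
    · have h1 : m ≤ Q z₀ (‖u‖⁻¹ • u) (‖u‖⁻¹ • u) :=
        hmin (by simp [norm_smul, inv_mul_cancel₀ (norm_ne_zero_iff.2 hu)])
      simp only [map_smul, smul_apply, smul_eq_mul] at h1
      have h2 := norm_pos_iff.2 hu
      calc m * ‖u‖ ^ 2 ≤ ‖u‖⁻¹ * (‖u‖⁻¹ * Q z₀ u u) * ‖u‖ ^ 2 := by gcongr
        _ = Q z₀ u u := by field_simp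
  set K := ‖Q z₀‖ + m
  have hK : 0 < K := by positivity
  set a := √(m / 2)
  have ha : 0 < a := Real.sqrt_pos.2 (by positivity)
  have haa : a * a = m / 2 := Real.mul_self_sqrt (by positivity)
  refine ⟨√K + a⁻¹, by positivity, ?_⟩
  filter_upwards [eventually_norm_sub_lt (G := E →L[ℝ] E →L[ℝ] ℝ) hQ (half_pos hm)] with z hz u
  have hd : |Q z u u - Q z₀ u u| ≤ m / 2 * ‖u‖ ^ 2 := by
    have h1 := (Q z - Q z₀).le_opNorm₂ u u
    simp only [sub_apply, Real.norm_eq_abs] at h1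
    nlinarith [mul_nonneg (norm_nonneg u) (norm_nonneg u)]
  have hup : Q z₀ u u ≤ ‖Q z₀‖ * ‖u‖ ^ 2 := by
    have h1 := (le_abs_self _).trans ((Q z₀).le_opNorm₂ u u)
    rwa [mul_assoc, ← sq] at h1
  have hd' := abs_le.1 hd
  have hl := hlow u
  have hu := sq_nonneg ‖u‖
  constructor
  · calc (√K + a⁻¹)⁻¹ * ‖u‖ ≤ a * ‖u‖ := by
          gcongr
          rw [inv_le_comm₀ (by positivity) ha]
          linarith [Real.sqrt_nonneg K]
      _ ≤ √(Q z u u) := Real.le_sqrt_of_sq_le (by nlinarith)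
  · calc √(Q z u u) ≤ √K * ‖u‖ := by
          rw [Real.sqrt_le_left (by positivity), mul_pow, Real.sq_sqrt hK.le]
          nlinarith
      _ ≤ (√K + a⁻¹) * ‖u‖ := by
          gcongr
          linarith [inv_pos.2 ha]

section Surface

attribute [local instance] chartedSpaceSelf

variable {M : Type*} [TopologicalSpace M] [ChartedSpace (EuclideanSpace ℝ (Fin 3)) M]
  [IsManifold (𝓡 3) ∞ M] {S : Type*} [TopologicalSpace S]
  [ChartedSpace (EuclideanSpace ℝ (Fin 2)) S] [IsManifold (𝓡 2) ∞ S]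
  {C : ContactSubRiemannian M} {i : S → M} {o : SurfaceOrientation S}
  {σ : ∀ p : S, TangentSpace (𝓡 2) p →L[ℝ] TangentSpace (𝓡 2) p →L[ℝ] ℝ}
  {X : ∀ p : S, TangentSpace (𝓡 2) p} {q : S}

/-- At a degenerate characteristic point the divergence is a non-zero eigenvalue of `D_q X`. -/
theorem exists_transverse_eigenvector (hi : IsSmoothEmbedding (𝓡 2) (𝓡 3) ∞ i)
    (hσ : IsAreaForm C i o σ) (hX : IsCharacteristicField C i σ X) (hq : IsCharacteristic C i q)
    {e : Plane} (he : e ≠ 0) (hAe : (differentialAt X q e : Plane) = 0) :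
    divergence σ X q ≠ 0 ∧
      ∃ f : Plane, (differentialAt X q f : Plane) = divergence σ X q • f ∧ cross e f ≠ 0 := by
  set A : Plane →L[ℝ] Plane := differentialAt X q
  set L := mfderiv (𝓡 2) (𝓡 3) i q
  -- Since `ι_X σ` is the pull-back of `ω`, its exterior derivative at `q` is `dω` on `T_q S = 𝓓_q`,
  -- where the contact condition supplies a `v` pairing non-trivially with `e`.
  have hform : (fun p ↦ σ p (X p)) = fun p ↦ (C.form (i p)).comp (mfderiv (𝓡 2) (𝓡 3) i p) :=
    funext fun p ↦ ContinuousLinearMap.ext fun v ↦ hX.interior_eq p v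
  have hLe : L e ≠ 0 := fun h ↦
    he (mfderiv_injective_of_isSmoothEmbedding hi q (h.trans (map_zero L).symm))
  have hLD : range L = {v | C.form (i q) v = 0} := hq
  have hLe' : C.form (i q) (L e) = 0 := by
    have : L e ∈ range L := mem_range_self _
    rwa [hLD] at this
  obtain ⟨w, hw, hdw⟩ := C.contact (i q) (L e) hLe' hLe
  obtain ⟨v, rfl⟩ : w ∈ range L := by rw [hLD]; exact hw
  have h1 := dOneForm_pullback hi.contMDiff C.smooth_form q e v
  rw [← hform] at h1
  rw [← h1] at hdw
  have h2 := dOneForm_interior hσ.isTwoForm hX.smooth (hX.eq_zero hσ hi hq) e v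
  have h3 := divergence_mul hσ.isTwoForm X q (hσ.ne_zero hi q) e v
  set τ := divergence σ X q
  set s := σ q (!₂[1, 0] : Plane) (!₂[0, 1] : Plane)
  have hs : s ≠ 0 := hσ.frame_ne_zero hi q
  have h4 : σ q e v = cross e v * s := hσ.eq_cross q e v
  have h5 : σ q (A e) v = cross (A e) v * s := hσ.eq_cross q (A e) v
  have h6 : σ q (A v) e = cross (A v) e * s := hσ.eq_cross q (A v) e
  rw [← h3] at hdw
  have hτ : τ ≠ 0 := left_ne_zero_of_mul hdw
  have hev : cross e v ≠ 0 := by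
    intro h
    rw [h4, h, zero_mul, mul_zero] at hdw
    exact hdw rfl
  refine ⟨hτ, exists_eigenvector hAe hτ hev ?_⟩
  -- At a zero of `X` this identifies the divergence with the trace of `D_q X`.
  have h7 : τ * (cross e v * s) = cross (A e) v * s - cross (A v) e * s := by
    rw [← h4, ← h5, ← h6]
    exact h3.trans h2
  have h8 := cross_swap (A v) e
  apply mul_right_cancel₀ hs
  rw [h8] at h7
  linarith

/-- Quantifying over `F` transfers any pointwise statement about `γ'(t)` to coordinates, although
the base points `γ t` and `chartInv q (extChartAt (𝓡 2) q (γ t))` give different tangent space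
types. -/
theorem contDiffAt_and_apply_velocity {γ : ℝ → S} {t : ℝ} (hγ : ContMDiffAt 𝓘(ℝ, ℝ) (𝓡 2) ∞ γ t)
    (ht : γ t ∈ (extChartAt (𝓡 2) q).source) :
    ContDiffAt ℝ ∞ (fun t ↦ extChartAt (𝓡 2) q (γ t)) t ∧
    ∀ {β : Type} (F : ∀ p : S, TangentSpace (𝓡 2) p → β), F (γ t) (velocity γ t) =
      F (chartInv q (extChartAt (𝓡 2) q (γ t)))
        (mfderiv (𝓡 2) (𝓡 2) (chartInv q) (extChartAt (𝓡 2) q (γ t))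
          (deriv (fun t ↦ extChartAt (𝓡 2) q (γ t)) t)) := by
  set c : ℝ → Plane := fun t ↦ extChartAt (𝓡 2) q (γ t)
  have hc : ContMDiffAt 𝓘(ℝ, ℝ) (𝓡 2) ∞ c t :=
    (contMDiffAt_extChartAt' (by rwa [← extChartAt_source (𝓡 2)])).comp t hγ
  refine ⟨hc.contDiffAt, fun F ↦ ?_⟩
  have hev : γ =ᶠ[𝓝 t] chartInv q ∘ c := by
    filter_upwards [hγ.continuousAt.preimage_mem_nhds
      ((isOpen_extChartAt_source q).mem_nhds ht)] with s hs
    exact ((extChartAt (𝓡 2) q).left_inv hs).symm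
  refine (apply_mfderiv_congr F hev 1).trans ?_
  have hcomp : mfderiv 𝓘(ℝ, ℝ) (𝓡 2) (chartInv q ∘ c) t = _ :=
    mfderiv_comp (I' := 𝓡 2) t
      (((contMDiffOn_chartInv q).contMDiffAt ((isOpen_extChartAt_target q).mem_nhds
        ((extChartAt (𝓡 2) q).map_source ht))).mdifferentiableAt (by simp))
      (hc.mdifferentiableAt (by simp))
  rw [hcomp, mfderiv_eq_fderiv]
  rfl

theorem mfderiv_chartInv_injective {z : Plane} (hz : z ∈ (extChartAt (𝓡 2) q).target) :
    Function.Injective (mfderiv (𝓡 2) (𝓡 2) (chartInv q) z) := by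
  have hM : IsManifold (𝓡 2) 1 S := IsManifold.of_le (n := ∞) (by simp)
  rw [← mfderivWithin_range_eq]
  exact (isInvertible_mfderivWithin_extChartAt_symm (I := 𝓡 2) hz).injective

/-- In the coordinates of the preferred chart, a horizontal kernel extension is an adapted curve. -/
theorem IsHorizontalKernelExtension.exists_adaptedCurve
    (hi : IsSmoothEmbedding (𝓡 2) (𝓡 3) ∞ i) (hσ : IsAreaForm C i o σ)
    (hX : IsCharacteristicField C i σ X) {γ : ℝ → S}
    (hγ : IsHorizontalKernelExtension C i X q γ) :
    let c : ℝ → Plane := fun t ↦ extChartAt (𝓡 2) q (γ t)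
    (∀ᶠ s in 𝓝 0, ContDiffAt ℝ ∞ c s) ∧ deriv c 0 ≠ 0 ∧
      (differentialAt X q (deriv c 0) : Plane) = 0 ∧
      ∀ {f : Plane} {τ : ℝ}, (differentialAt X q f : Plane) = τ • f → τ ≠ 0 →
        cross (deriv c 0) f ≠ 0 →
        AdaptedCurve (fieldInChart X q) (differentialAt X q) (extChartAt (𝓡 2) q q) f τ c
          (lam C i X γ) := by
  intro c
  obtain ⟨ε, hε, hs, hh, h0, hker⟩ := hγ
  subst h0
  set q := γ 0
  have hIoo : ∀ᶠ t in 𝓝 (0 : ℝ), t ∈ Ioo (-ε) ε := isOpen_Ioo.mem_nhds (by simp [hε])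
  have hsm : ∀ t ∈ Ioo (-ε) ε, ContMDiffAt 𝓘(ℝ, ℝ) (𝓡 2) ∞ γ t := fun t ht ↦
    hs.contMDiffAt (isOpen_Ioo.mem_nhds ht)
  have hsrc : ∀ᶠ t in 𝓝 (0 : ℝ), γ t ∈ (extChartAt (𝓡 2) q).source :=
    (hsm 0 (by simp [hε])).continuousAt.preimage_mem_nhds (extChartAt_source_mem_nhds q)
  have hcs : ∀ᶠ s in 𝓝 0, ContDiffAt ℝ ∞ c s := by
    filter_upwards [hIoo, hsrc] with t ht ht'
    exact (contDiffAt_and_apply_velocity (hsm t ht) ht').1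
  -- The chart is the preferred one at `γ 0`, so at `t = 0` the velocity is the coordinate
  -- derivative itself.
  have h00 {β : Type} (F : ∀ p : S, TangentSpace (𝓡 2) p → β) :
      F q (velocity γ 0) = F q (deriv c 0) :=
    ((contDiffAt_and_apply_velocity (hsm 0 (by simp [hε])) hsrc.self_of_nhds).2 F).trans
      (apply_mfderiv_chartInv F q _)
  refine ⟨hcs, ?_, ?_, ?_⟩
  · intro hzero
    have h1 := (hh 0 (by simp [hε])).2
    have h2 := h00 fun p w ↦ C.g (i p) (mfderiv (𝓡 2) (𝓡 3) i p w) (mfderiv (𝓡 2) (𝓡 3) i p w)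
    have h3 : mfderiv (𝓡 2) (𝓡 3) i q (deriv c 0) = 0 :=
      (congrArg (mfderiv (𝓡 2) (𝓡 3) i q) hzero).trans (map_zero (mfderiv (𝓡 2) (𝓡 3) i q))
    have h4 : C.g (i q) (mfderiv (𝓡 2) (𝓡 3) i q (deriv c 0))
        (mfderiv (𝓡 2) (𝓡 3) i q (deriv c 0)) = 0 := by
      rw [h3, map_zero]
    exact one_ne_zero (h1.symm.trans (h2.trans h4))
  · exact (h00 fun p w ↦ (differentialAt X p w : Plane)).symm.trans hker
  · intro f τ hf hτ hcr
    refine ⟨?_, rfl, hcs.self_of_nhds, hf, hτ, hcr, ?_⟩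
    · exact (contDiffAt_fieldInChart hX.smooth q).hasStrictFDerivAt (by simp)
    · filter_upwards [hIoo, hsrc] with t ht ht'
      have hF := @(contDiffAt_and_apply_velocity (hsm t ht) ht').2
      have hz : c t ∈ (extChartAt (𝓡 2) q).target := (extChartAt (𝓡 2) q).map_source ht'
      set p := chartInv q (c t) with hp
      set w : TangentSpace (𝓡 2) p := mfderiv (𝓡 2) (𝓡 2) (chartInv q) (c t) (deriv c t) with hw
      have hpγ : p = γ t := (extChartAt (𝓡 2) q).left_inv ht'
      have h1 : C.form (i p) (mfderiv (𝓡 2) (𝓡 3) i p w) = 0 :=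
        (hF fun p w ↦ C.form (i p) (mfderiv (𝓡 2) (𝓡 3) i p w)).symm.trans (hh t ht).1
      have h2 : C.g (i p) (mfderiv (𝓡 2) (𝓡 3) i p w) (mfderiv (𝓡 2) (𝓡 3) i p w) = 1 :=
        (hF fun p w ↦ C.g (i p) (mfderiv (𝓡 2) (𝓡 3) i p w)
          (mfderiv (𝓡 2) (𝓡 3) i p w)).symm.trans (hh t ht).2
      have h3 : lam C i X γ t =
          C.g (i p) (mfderiv (𝓡 2) (𝓡 3) i p (X p)) (mfderiv (𝓡 2) (𝓡 3) i p w) :=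
        hF fun p w ↦ C.g (i p) (mfderiv (𝓡 2) (𝓡 3) i p (X p)) (mfderiv (𝓡 2) (𝓡 3) i p w)
      -- Horizontality gives `σ(X, γ') = ω(γ') = 0`, so `X` is parallel to `γ'`.
      have h4 : cross (X p) w = 0 :=
        (mul_eq_zero.1 ((hσ.eq_cross p (X p) w).symm.trans
          ((hX.interior_eq p w).trans h1))).resolve_right (hσ.frame_ne_zero hi p)
      have hw0 : (w : Plane) ≠ 0 := by
        intro h
        have h5 : mfderiv (𝓡 2) (𝓡 3) i p w = 0 :=
          (congrArg (mfderiv (𝓡 2) (𝓡 3) i p) h).trans (map_zero (mfderiv (𝓡 2) (𝓡 3) i p))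
        rw [h5, map_zero] at h2
        exact zero_ne_one h2
      obtain ⟨a, ha⟩ := exists_eq_smul_of_cross_eq_zero h4 hw0
      have ha' : X p = a • w := ha
      -- Unit speed turns the factor of proportionality into `g(X, γ')`.
      have h6 : lam C i X γ t = a := by
        rw [h3, ha', map_smul, map_smul, smul_apply, h2, smul_eq_mul, mul_one]
      apply mfderiv_chartInv_injective hz
      rw [h6]
      refine (mfderiv_fieldInChart X q hz).trans (ha'.trans ?_)
      exact (map_smul (mfderiv (𝓡 2) (𝓡 2) (chartInv q) (c t)) a (deriv c t)).symm

/-- Near a characteristic point, the sub-Riemannian norm of `X` is comparable with the Euclidean norm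
in the preferred chart. -/
theorem exists_srNorm_bounds (hi : IsSmoothEmbedding (𝓡 2) (𝓡 3) ∞ i)
    (hq : IsCharacteristic C i q) (X : ∀ p : S, TangentSpace (𝓡 2) p) :
    ∃ c > 0, ∀ᶠ z in 𝓝 (extChartAt (𝓡 2) q q),
      c⁻¹ * ‖fieldInChart X q z‖ ≤ srNorm C i X (chartInv q z) ∧
      srNorm C i X (chartInv q z) ≤ c * ‖fieldInChart X q z‖ := by
  set z₀ := extChartAt (𝓡 2) q q with hz₀
  set Q := pullbackBilinear C.g (i ∘ chartInv (n := 2) q) with hQ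
  have hb : ContMDiffOn (𝓡 2) (𝓡 3) ∞ (i ∘ chartInv q) (extChartAt (𝓡 2) q).target :=
    hi.contMDiff.comp_contMDiffOn (contMDiffOn_chartInv q)
  have hQc : ContinuousAt Q z₀ :=
    (contDiffOn_pullback_bilinear C.smooth_g (isOpen_extChartAt_target q) hb).continuousOn.continuousAt
      (extChartAt_target_mem_nhds q)
  have hQe {z : Plane} (hz : z ∈ (extChartAt (𝓡 2) q).target) (u : Plane) : Q z u u =
      C.g (i (chartInv q z))
        (mfderiv (𝓡 2) (𝓡 3) i (chartInv q z) (mfderiv (𝓡 2) (𝓡 2) (chartInv q) z u))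
        (mfderiv (𝓡 2) (𝓡 3) i (chartInv q z) (mfderiv (𝓡 2) (𝓡 2) (chartInv q) z u)) := by
    have hcomp : mfderiv (𝓡 2) (𝓡 3) (i ∘ chartInv q) z = _ :=
      mfderiv_comp (I' := 𝓡 2) z (hi.contMDiff.mdifferentiableAt (by simp))
        (((contMDiffOn_chartInv q).contMDiffAt
          ((isOpen_extChartAt_target q).mem_nhds hz)).mdifferentiableAt (by simp))
    rw [hQ]
    unfold pullbackBilinear
    rw [hcomp]
    rfl
  -- Here `T_q S = 𝓓_q` is used: `g` is known to be positive on horizontal vectors only, and nearby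
  -- tangent planes of `S` are reached by continuity.
  have hpos (u : Plane) (hu : u ≠ 0) : 0 < Q z₀ u u := by
    rw [hQe (mem_extChartAt_target q)]
    have h1 := apply_mfderiv_chartInv (fun p w ↦
      C.g (i p) (mfderiv (𝓡 2) (𝓡 3) i p w) (mfderiv (𝓡 2) (𝓡 3) i p w)) q u
    refine lt_of_lt_of_eq ?_ h1.symm
    refine C.g_pos (i q) _ ?_ fun h ↦ hu (mfderiv_injective_of_isSmoothEmbedding hi q
      (h.trans (map_zero (mfderiv (𝓡 2) (𝓡 3) i q)).symm))
    have h2 : mfderiv (𝓡 2) (𝓡 3) i q u ∈ range (mfderiv (𝓡 2) (𝓡 3) i q) := mem_range_self _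
    rw [hq] at h2
    exact h2
  obtain ⟨c, hc, hev⟩ := exists_sqrt_bounds hQc hpos
  refine ⟨c, hc, ?_⟩
  filter_upwards [hev, extChartAt_target_mem_nhds (I := 𝓡 2) q] with z hz hzt
  have h1 : srNorm C i X (chartInv q z) = √(Q z (fieldInChart X q z) (fieldInChart X q z)) := by
    rw [hQe hzt, mfderiv_fieldInChart X q hzt]
    rfl
  rw [h1]
  exact hz _

end Surface

end ContactSR

end

/-! ### The theorem: coordinates, isolation and index -/

open ContactSR in
theorem theorem1p6
    {M : Type*} [TopologicalSpace M] [ChartedSpace (EuclideanSpace ℝ (Fin 3)) M]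
    [IsManifold (𝓡 3) ∞ M]
    {S : Type*} [TopologicalSpace S] [ChartedSpace (EuclideanSpace ℝ (Fin 2)) S]
    [IsManifold (𝓡 2) ∞ S]
    (C : ContactSubRiemannian M)
    (i : S → M) (hi : IsSmoothEmbedding (𝓡 2) (𝓡 3) ∞ i)
    (o : SurfaceOrientation S)
    (σ : ∀ p : S, TangentSpace (𝓡 2) p →L[ℝ] TangentSpace (𝓡 2) p →L[ℝ] ℝ)
    (hσ : IsAreaForm C i o σ)
    (X : ∀ p : S, TangentSpace (𝓡 2) p) (hX : IsCharacteristicField C i σ X)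
    (q : S) (k : ℕ) (hk : 2 ≤ k) (hq : HasOrderOfDegeneracy C i X q k) :
    (∀ᶠ p in 𝓝[≠] q, ¬ IsCharacteristic C i p) ∧
    (∃ φ ∈ IsManifold.maximalAtlas (𝓡 2) ∞ S, q ∈ φ.source ∧ φ q = 0 ∧
      ∃ c : ℝ, 0 < c ∧ ∀ p ∈ φ.source,
        c⁻¹ * √(φ p 0 ^ 2 + φ p 1 ^ (2 * k)) ≤ srNorm C i X p ∧
        srNorm C i X p ≤ c * √(φ p 0 ^ 2 + φ p 1 ^ (2 * k))) ∧
    (Odd k → ∀ γ : ℝ → S, IsHorizontalKernelExtension C i X q γ →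
      HasIndex X q (SignType.sign (divergence σ X q * iteratedDeriv k (lam C i X γ) 0) : ℤ)) ∧
    (Even k → HasIndex X q 0) := by
  obtain ⟨hchar, ⟨-, rfl⟩ | ⟨-, γ, hγ, hv⟩⟩ := hq
  · omega
  have hY := contDiffAt_fieldInChart hX.smooth q
  obtain ⟨hcs, hne, hker, had⟩ := hγ.exists_adaptedCurve hi hσ hX
  obtain ⟨hτ, f, hf, hcr⟩ := exists_transverse_eigenvector hi hσ hX hchar hne hker
  have h := had hf hτ hcr
  have hii : ∃ φ ∈ IsManifold.maximalAtlas (𝓡 2) ∞ S, q ∈ φ.source ∧ φ q = 0 ∧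
      ∃ c : ℝ, 0 < c ∧ ∀ p ∈ φ.source,
        c⁻¹ * √(φ p 0 ^ 2 + φ p 1 ^ (2 * k)) ≤ srNorm C i X p ∧
        srNorm C i X p ≤ c * √(φ p 0 ^ 2 + φ p 1 ^ (2 * k)) := by
    obtain ⟨l, hl, hl0, hlam⟩ := exists_eq_pow_mul (h.contDiffAt_lam hY) (k := k)
      (fun j hj ↦ by by_contra hne; exact absurd (hv.2 hne) (not_le.2 hj))
    have hl0' : l 0 ≠ 0 := by
      rw [hl0]
      exact div_ne_zero hv.1 (by positivity)
    obtain ⟨a, ha, hnb⟩ := h.exists_norm_bounds hl hl0' hlam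
    obtain ⟨b, hb, hsb⟩ := exists_srNorm_bounds hi hchar X
    -- Both norm comparisons are built into the source of `ψ`; the required chart is the preferred
    -- one followed by the inverse of `ψ`.
    obtain ⟨ψ, hψ, h0, hp, hs, hs'⟩ := h.exists_openPartialHomeomorph hcs
      (hnb.and (h.tendsto_adaptedMap.eventually hsb))
    have hψ0 : ψ 0 = chartAt (EuclideanSpace ℝ (Fin 2)) q q := by
      rw [hψ]
      exact (by simp [adaptedMap] : adaptedMap _ f 0 = _).trans h.start
    refine ⟨(chartAt (EuclideanSpace ℝ (Fin 2)) q).trans ψ.symm, ?_, ?_, ?_, b * a,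
      mul_pos hb ha, ?_⟩
    · refine OpenPartialHomeomorph.mem_maximalAtlas_of_contMDiffOn _ ?_ ?_
      · exact hs'.contMDiffOn.comp (contMDiffOn_chart.mono fun p hp ↦ hp.1) fun p hp ↦ hp.2
      · exact contMDiffOn_chart_symm.comp (hs.contMDiffOn.mono fun w hw ↦ hw.1) fun w hw ↦ hw.2
    · rw [OpenPartialHomeomorph.trans_source]
      refine ⟨mem_chart_source _ q, ?_⟩
      rw [mem_preimage, ← hψ0]
      exact ψ.map_source h0
    · change ψ.symm (chartAt (EuclideanSpace ℝ (Fin 2)) q q) = 0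
      rw [← hψ0, ψ.left_inv h0]
    · intro p hps
      rw [OpenPartialHomeomorph.trans_source] at hps
      set w := (chartAt (EuclideanSpace ℝ (Fin 2)) q).trans ψ.symm p
      have hw : w ∈ ψ.source := ψ.map_target hps.2
      have hinv : chartInv q (adaptedMap (fun t ↦ extChartAt (𝓡 2) q (γ t)) f w) = p := by
        rw [← hψ]
        exact (congrArg (chartInv q) (ψ.right_inv hps.2)).trans
          ((chartAt (EuclideanSpace ℝ (Fin 2)) q).left_inv hps.1)
      obtain ⟨⟨h1, h2⟩, h3, h4⟩ := hp w hw
      rw [hinv] at h3 h4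
      constructor
      · calc (b * a)⁻¹ * √(w 0 ^ 2 + w 1 ^ (2 * k)) = b⁻¹ * (a⁻¹ * √(w 0 ^ 2 + w 1 ^ (2 * k))) := by
              rw [mul_inv, mul_assoc]
          _ ≤ _ := by gcongr
          _ ≤ _ := h3
      · calc srNorm C i X p ≤ _ := h4
          _ ≤ b * (a * √(w 0 ^ 2 + w 1 ^ (2 * k))) := by gcongr
          _ = _ := by rw [mul_assoc]
  refine ⟨?_, hii, fun hodd γ' hγ' ↦ ?_, fun heven ↦ h.index_of_even hY hcs hv heven⟩
  -- Isolation follows from (ii): `X` vanishes at characteristic points, while the lower bound is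
  -- positive away from `q`.
  · obtain ⟨φ, -, hqφ, hφq, c, hc, hφ⟩ := hii
    rw [eventually_nhdsWithin_iff]
    filter_upwards [φ.open_source.mem_nhds hqφ] with p hp hpq hpc
    apply hpq
    have h1 : srNorm C i X p = 0 := by
      unfold srNorm
      rw [hX.eq_zero hσ hi hpc]
      simp
    have h2 := (hφ p hp).1
    rw [h1] at h2
    have h3 : φ p 0 ^ 2 + φ p 1 ^ (2 * k) ≤ 0 :=
      Real.sqrt_eq_zero'.1 (le_antisymm (nonpos_of_mul_nonpos_right h2 (inv_pos.2 hc))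
        (Real.sqrt_nonneg _))
    have h4 : 0 ≤ φ p 1 ^ (2 * k) := (even_two_mul k).pow_nonneg _
    have h5 := sq_nonneg (φ p 0)
    have h6 : φ p 0 = 0 := pow_eq_zero_iff two_ne_zero |>.1 (by linarith)
    have h7 : φ p 1 = 0 := pow_eq_zero_iff (by omega : 2 * k ≠ 0) |>.1 (by linarith)
    refine φ.injOn hp hqφ ?_
    rw [hφq]
    ext j; fin_cases j
    · exact h6
    · exact h7
  · obtain ⟨hcs', hne', hker', had'⟩ := hγ'.exists_adaptedCurve hi hσ hX
    have hf0 : f ≠ 0 := by rintro rfl; exact hcr (cross_zero_right _)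
    -- The velocity of `γ'` at `0` lies in the kernel and `f` has eigenvalue `τ ≠ 0`, so they are
    -- not parallel: the same `f` serves every kernel extension.
    have h' := had' hf hτ fun h0 ↦ by
      obtain ⟨a, ha⟩ := exists_eq_smul_of_cross_eq_zero h0 hf0
      have h1 : a • divergence σ X q • f = 0 :=
        ((congrArg (a • ·) hf).symm.trans (map_smul (differentialAt X q) a f).symm).trans
          ((congrArg (differentialAt X q) ha).symm.trans hker')
      rcases smul_eq_zero.1 h1 with h2 | h2
      · rw [h2, zero_smul] at ha
        exact hne' ha
      · exact smul_ne_zero hτ hf0 h2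
    exact h'.index_of_odd hY hcs' (h.vanishesToOrder hY hcs hv h' hcs') hodd
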